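/- **Definitions.** *$(p,q)$-Fair Clustering.* An instance consists of a metric space $([m],d)$, weight functions $w_1,\dots,w_n:[m]\to\mathbb{R}_{\ge 0}$ (all numbers rational, given in binary) and an integer $1\le k\le m$. The goal is to find $C\subseteq[m]$ with $|C|=k$ minimizing $$\mathrm{cost}_{p,q}(C)=\Big(\sum_{i=1}^n\Big(\sum_{j=1}^m w_i(j)\,d(j,C)^p\Big)^{q/p}\Big)^{1/q},\qquad d(j,C)=\min_{j'\in C}d(j,j').$$ For $\rho:\mathbb{N}\to\mathbb{R}$, a polynomial-time $\rho(m)$-approximation algorithm is a polynomial-time algorithm that on every instance with $m$ points outputs a set of $k$ centers of cost at most $\rho(m)$ times the optimum (with probability at least $2/3$ over its coins, if it is randomized). *Dense versus Random.* For $0<\varepsilon<\delta<1$ consider inputs consisting of an integer $s$ and $m$ sets $S_1,\dots,S_m\subseteq[n]$, where $s=m^{\varepsilon}$ and $n=10\,m^{\varepsilon}\ln m$ (here and below, non-integral quantities are rounded down), of one of two kinds. - *Random:* each $S_j$ is the set of $10\ln m$ elements of $[n]$ drawn independently and uniformly at random, independently for all $j$. - *Dense:* the sets are arbitrary, except that there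 are $J\subseteq[m]$ and $I\subseteq[n]$ with $|J|=s$, $|I|\le(10s\ln m)^{\delta}$ and $S_j\subseteq I$ for all $j\in J$. The Dense versus Random Conjecture holds for $\varepsilon,\delta$ (with $s=m^\varepsilon$) if there is no polynomial-time algorithm that, for all sufficiently large $m$, answers "dense" on every Dense input (with probability at least $2/3$ over its coins, if it is randomized), and that answers "random" on a Random input with probability $1-o(1)$ as $m\to\infty$ (over the input and its coins). **Theorem.** Let $1\le q\le p<\infty$ and $0<\varepsilon<\delta<1$ be constants with $\varepsilon\le\frac12$, and suppose that the Dense versus Random Conjecture holds for $\varepsilon,\delta$ (with $s=m^\varepsilon$). Then $(p,q)$-Fair Clustering is hard to approximate within less than $m^{\varepsilon(1-\delta)(p-q)/(pq)}$: for every $\rho:\mathbb{N}\to\mathbb{R}$ with $\rho(m)<m^{\varepsilon(1-\delta)(p-q)/(pq)}$ for all sufficiently large $m$, there is no polynomial-time $\rho(m)$-approximation algorithm for $(p,q)$-Fair Clustering. This holds both when "algorithm" means deterministic algorithm throughout and when it means randomized algorithm throughout. -/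

import Mathlib

open Filter Topology MeasureTheory

namespace FairClustering

/-! ### The model of computation

Structured programs that manipulate binary trees, with coin tossing.  A program has finitely many
variables (indexed by natural numbers) that hold trees; an assignment is charged one plus the size
of the tree it stores, every test and every coin toss is charged one.  Since every stored tree has
been paid for, these programs and (probabilistic) Turing machines simulate each other with a
polynomial overhead. -/

/-- The data: binary trees without labels. -/
inductive Data : Type
  | nil : Data
  | node : Data → Data → Data

namespace Data

/-- The number of vertices of a tree. -/
def size : Data → ℕ
  | nil => 1
  | node a b => 1 + a.size + b.size

/-- The left subtree (`nil` for `nil`). -/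
def head : Data → Data
  | nil => nil
  | node a _ => a

/-- The right subtree (`nil` for `nil`). -/
def tail : Data → Data
  | nil => nil
  | node _ b => b

/-- Truth values: false is `nil`, true is the tree with one inner vertex. -/
def ofBool : Bool → Data
  | false => nil
  | true => node nil nil

/-- Lists of trees. -/
def ofList : List Data → Data
  | [] => nil
  | a :: l => node a (ofList l)

/-- Natural numbers in unary. -/
def ofUnary (n : ℕ) : Data := ofList (List.replicate n nil)

/-- Natural numbers in binary, least significant digit first. -/
def ofBinary (n : ℕ) : Data := ofList (n.bits.map ofBool)

/-- Non-negative rationals as reduced fractions of binary numbers. -/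
def ofNNRat (x : NNRat) : Data := node (ofBinary x.num) (ofBinary x.den)

/-- Subsets of `{0, …, m - 1}` as lists of `m` truth values. -/
def ofFinset {m : ℕ} (C : Finset (Fin m)) : Data :=
  ofList ((List.finRange m).map fun j => ofBool (decide (j ∈ C)))

end Data

/-- An assignment of trees to the variables. -/
abbrev Store : Type := ℕ → Data

/-- Expressions. -/
inductive Expr : Type
  | nil : Expr
  | var : ℕ → Expr
  | node : Expr → Expr → Expr
  | head : Expr → Expr
  | tail : Expr → Expr

/-- The value of an expression. -/
def Expr.eval (σ : Store) : Expr → Data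
  | .nil => Data.nil
  | .var x => σ x
  | .node a b => Data.node (a.eval σ) (b.eval σ)
  | .head a => (a.eval σ).head
  | .tail a => (a.eval σ).tail

/-- Programs. -/
inductive Program : Type
  | skip : Program
  | assign : ℕ → Expr → Program
  | toss : ℕ → Program
  | seq : Program → Program → Program
  | branch : Expr → Program → Program → Program
  | loop : Expr → Program → Program

/-- A program is deterministic if it contains no coin toss. -/
def Program.Deterministic : Program → Prop
  | .skip => True
  | .assign _ _ => True
  | .toss _ => False
  | .seq a b => a.Deterministic ∧ b.Deterministic
  | .branch _ a b => a.Deterministic ∧ b.Deterministic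
  | .loop _ a => a.Deterministic

/-- The state of a computation: the contents of the variables and the coins not yet tossed. -/
structure State : Type where
  store : Store
  coins : ℕ → Bool

/-- `Run c st st' t`: started in `st`, the program `c` halts in `st'` after `t` steps.  A branch or
a loop tests whether the value of its expression is different from `nil`. -/
inductive Run : Program → State → State → ℕ → Prop
  | skip (st : State) : Run .skip st st 1
  | assign (x : ℕ) (e : Expr) (st : State) :
      Run (.assign x e) st ⟨Function.update st.store x (e.eval st.store), st.coins⟩
        (1 + (e.eval st.store).size)
  | toss (x : ℕ) (st : State) :
      Run (.toss x) st
        ⟨Function.update st.store x (Data.ofBool (st.coins 0)), fun i => st.coins (i + 1)⟩ 1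
  | seq {a b : Program} {st st' st'' : State} {t t' : ℕ} :
      Run a st st' t → Run b st' st'' t' → Run (.seq a b) st st'' (t + t')
  | branch_true {e : Expr} {a b : Program} {st st' : State} {t : ℕ} :
      e.eval st.store ≠ Data.nil → Run a st st' t → Run (.branch e a b) st st' (1 + t)
  | branch_false {e : Expr} {a b : Program} {st st' : State} {t : ℕ} :
      e.eval st.store = Data.nil → Run b st st' t → Run (.branch e a b) st st' (1 + t)
  | loop_true {e : Expr} {a : Program} {st st' st'' : State} {t t' : ℕ} :
      e.eval st.store ≠ Data.nil → Run a st st' t → Run (.loop e a) st' st'' t' →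
        Run (.loop e a) st st'' (1 + t + t')
  | loop_false {e : Expr} {a : Program} {st : State} :
      e.eval st.store = Data.nil → Run (.loop e a) st st 1

/-- The initial state: the input is in variable `0`, all other variables are `nil`. -/
def initState (x : Data) (ω : ℕ → Bool) : State :=
  ⟨Function.update (fun _ => Data.nil) 0 x, ω⟩

/-- On input `x` and coins `ω`, the program halts after `t` steps with `y` in variable `0`. -/
def HaltsWith (c : Program) (x : Data) (ω : ℕ → Bool) (y : Data) (t : ℕ) : Prop :=
  ∃ st : State, Run c (initState x ω) st t ∧ st.store 0 = y

/-- On input `x` and coins `ω`, the program halts with output `y`. -/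
def Outputs (c : Program) (x : Data) (ω : ℕ → Bool) (y : Data) : Prop :=
  ∃ t : ℕ, HaltsWith c x ω y t

/-- On all inputs from `X` and for all coins, the program halts within a number of steps that is
polynomial in the size of the input. -/
def PolyTimeOn (c : Program) (X : Set Data) : Prop :=
  ∃ P : Polynomial ℕ, ∀ x ∈ X, ∀ ω : ℕ → Bool,
    ∃ (y : Data) (t : ℕ), HaltsWith c x ω y t ∧ t ≤ P.eval x.size

/-- The law of an infinite sequence of independent fair coins. -/
noncomputable def coinMeasure : Measure (ℕ → Bool) :=
  Measure.infinitePi fun _ : ℕ => (PMF.uniformOfFintype Bool).toMeasure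

/-- The two usual notions of an efficient algorithm. -/
inductive Mode : Type
  | deterministic : Mode
  | randomized : Mode

/-- The programs that are admitted in each mode. -/
def Mode.Admits : Mode → Program → Prop
  | .deterministic, c => c.Deterministic
  | .randomized, _ => True

/-! ### Fair clustering -/

/-- An instance of fair clustering: a metric on `m` points, `n` weight functions and a number of
centers, with rational data. -/
structure Instance : Type where
  m : ℕ
  n : ℕ
  k : ℕ
  d : Fin m → Fin m → NNRat
  w : Fin n → Fin m → NNRat
  d_eq_zero : ∀ i j, d i j = 0 ↔ i = j
  d_comm : ∀ i j, d i j = d j i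
  d_triangle : ∀ i j l, d i l ≤ d i j + d j l
  one_le_k : 1 ≤ k
  k_le_m : k ≤ m

namespace Instance

/-- The distance of a point to a (non-empty) set of centers; the infimum is a minimum. -/
noncomputable def distTo (I : Instance) (j : Fin I.m) (C : Finset (Fin I.m)) : ℝ :=
  ⨅ c : C, (I.d j c : ℝ)

/-- The `ℓ_p`-cost of the group `i`. -/
noncomputable def groupCost (I : Instance) (p : ℝ) (C : Finset (Fin I.m)) (i : Fin I.n) : ℝ :=
  (∑ j : Fin I.m, (I.w i j : ℝ) * I.distTo j C ^ p) ^ (1 / p)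

/-- The `(ℓ_p, ℓ_q)`-cost. -/
noncomputable def cost (I : Instance) (p q : ℝ) (C : Finset (Fin I.m)) : ℝ :=
  (∑ i : Fin I.n, I.groupCost p C i ^ q) ^ (1 / q)

/-- `C` is a set of `k` centers whose cost is at most `ρ` times the optimum. -/
def IsApprox (I : Instance) (p q ρ : ℝ) (C : Finset (Fin I.m)) : Prop :=
  C.card = I.k ∧
    ∀ C' : Finset (Fin I.m), C'.card = I.k → I.cost p q C ≤ ρ * I.cost p q C'

/-- The input: `k` in unary (recall `k ≤ m`), the matrix of distances row by row, and, point by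
point, the list of the `n` weights of that point. -/
def encode (I : Instance) : Data :=
  Data.node (Data.ofUnary I.k) <| Data.node
    (Data.ofList ((List.finRange I.m).map fun i =>
      Data.ofList ((List.finRange I.m).map fun j => Data.ofNNRat (I.d i j))))
    (Data.ofList ((List.finRange I.m).map fun j =>
      Data.ofList ((List.finRange I.n).map fun i => Data.ofNNRat (I.w i j))))

end Instance

/-- `c` is a polynomial-time algorithm that on every instance with `m` points finds a
`ρ(m)`-approximate solution of `(p,q)`-fair clustering with probability at least `2/3`
(hence always, if `c` is deterministic). -/
def Approximates (c : Program) (p q : ℝ) (ρ : ℕ → ℝ) : Prop :=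
  PolyTimeOn c (Set.range Instance.encode) ∧
    ∀ I : Instance, 2 / 3 ≤ coinMeasure.real
      {ω | ∃ C : Finset (Fin I.m), I.IsApprox p q (ρ I.m) C ∧
        Outputs c I.encode ω (Data.ofFinset C)}

/-- No efficient algorithm approximates `(p,q)`-fair clustering within less than `f(m)`. -/
def HardToApproximateWithinLessThan (mode : Mode) (p q : ℝ) (f : ℕ → ℝ) : Prop :=
  ∀ ρ : ℕ → ℝ, (∀ᶠ m in atTop, ρ m < f m) →
    ¬ ∃ c : Program, mode.Admits c ∧ Approximates c p q ρ

/-! ### Dense versus random -/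

/-- The input of Min `s`-Union: the parameter `s` in unary (recall `s ≤ m`) and the list of the
`m` sets, each a list of `n` truth values. -/
def encodeMinUnion {m n : ℕ} (S : Fin m → Finset (Fin n)) (s : ℕ) : Data :=
  Data.node (Data.ofUnary s) (Data.ofList ((List.finRange m).map fun j => Data.ofFinset (S j)))

/-- The set of all inputs of Min `s`-Union. -/
def minUnionInputs : Set Data :=
  {x | ∃ (m n s : ℕ) (S : Fin m → Finset (Fin n)), 1 ≤ s ∧ s ≤ m ∧ x = encodeMinUnion S s}

/-- The size `n = 10 m^ε ln m` of the ground set. -/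
noncomputable def groundSize (ε : ℝ) (m : ℕ) : ℕ := ⌊10 * (m : ℝ) ^ ε * Real.log m⌋₊

/-- The number `10 ln m` of elements drawn for a random set. -/
noncomputable def drawCount (m : ℕ) : ℕ := ⌊10 * Real.log m⌋₊

/-- The parameter `s = m^ε`. -/
noncomputable def unionParam (ε : ℝ) (m : ℕ) : ℕ := ⌊(m : ℝ) ^ ε⌋₊

/-- The sets given by a table of draws: the set `j` consists of all `f j l`. -/
def drawnSets {m r n : ℕ} (f : Fin m → Fin r → Fin n) (j : Fin m) : Finset (Fin n) :=
  Finset.univ.image (f j)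

/-- The dense case: some `s` of the sets lie in one set of at most `(10 s ln m)^δ` elements. -/
def IsDense {m n : ℕ} (δ : ℝ) (s : ℕ) (S : Fin m → Finset (Fin n)) : Prop :=
  ∃ (J : Finset (Fin m)) (I : Finset (Fin n)), J.card = s ∧
    (I.card : ℝ) ≤ (10 * (s : ℝ) * Real.log m) ^ δ ∧ ∀ j ∈ J, S j ⊆ I

/-- The program answers "dense". -/
def Accepts (c : Program) (x : Data) (ω : ℕ → Bool) : Prop := Outputs c x ω (Data.ofBool true)

/-- The program answers "random". -/
def Rejects (c : Program) (x : Data) (ω : ℕ → Bool) : Prop := Outputs c x ω (Data.ofBool false)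

/-- The probability, over independent uniform draws and over the coins, that `c` answers "random"
on a random instance with `m` sets. -/
noncomputable def randomRejectProb (c : Program) (ε : ℝ) (s : ℕ → ℕ) (m : ℕ) : ℝ :=
  (∑ f : Fin m → Fin (drawCount m) → Fin (groundSize ε m),
      coinMeasure.real {ω | Rejects c (encodeMinUnion (drawnSets f) (s m)) ω}) /
    Fintype.card (Fin m → Fin (drawCount m) → Fin (groundSize ε m))

/-- `c` is a polynomial-time algorithm that, for all large `m`, answers "dense" on every dense
instance with probability at least `2/3` over its coins (hence always, if `c` is deterministic), and
that answers "random" on a random instance with probability `1 - o(1)`. -/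
def Distinguishes (c : Program) (ε δ : ℝ) (s : ℕ → ℕ) : Prop :=
  PolyTimeOn c minUnionInputs ∧
    (∀ᶠ m in atTop, ∀ S : Fin m → Finset (Fin (groundSize ε m)), IsDense δ (s m) S →
      2 / 3 ≤ coinMeasure.real {ω | Accepts c (encodeMinUnion S (s m)) ω}) ∧
    Tendsto (randomRejectProb c ε s) atTop (𝓝 1)

/-- The Dense versus Random Conjecture for the parameters `ε`, `δ` and `s = s(m)`: no efficient
algorithm distinguishes the two cases. -/
def DenseVersusRandom (mode : Mode) (ε δ : ℝ) (s : ℕ → ℕ) : Prop :=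
  ¬ ∃ c : Program, mode.Admits c ∧ Distinguishes c ε δ s

end FairClustering

/-! The sets become the points of a uniform metric, each element `i` becomes a group whose weight is
the indicator of `i ∈ S j`, and `m - s` centers are opened. Choosing centers then means choosing `s`
sets to leave out. The `q`-th power of the cost is the sum over `i` of `deg(i)^(q/p)`, where
`deg(i)` counts the left-out sets that contain `i`. Degrees are integers, so this power is at least
the size of the union of the left-out sets (`card_biUnion_le_cost_rpow`). Conversely, if the
left-out sets lie in `T` and have total size at most `n`, Hölder bounds it by `|T|^(1-q/p) n^(q/p)`
(`cost_rpow_le`). Put `X = 10 m^ε ln m`, so `n = ⌊X⌋`. On a dense input `|T| ≤ X^δ`, and an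
approximation within the forbidden factor leaves out sets whose union has size at most `X (10 ln
m)^(-(1-δ)(1-q/p))`, which is below `n/4` for large `m` (`eventually_four_mul_lt_groundSize`). On a
random input a union bound shows that with probability at least `1 - 1/m` any `s` sets cover at
least `n/4` elements (`card_not_spread_mul_le`, `eventually_mul_pow_le`). Testing whether the
left-out union is smaller than `n/4` therefore separates the two cases. The sets of a dense input
are arbitrary, so their total size need not be at most `n`. The test hence also answers "dense" if
some set has `s |S j| > n`, which never happens for drawn sets. For `p = q` the factor is `1`, and
no algorithm beats a positive optimum (`not_approximates_of_lt_one`). The reduction has to be an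
actual program. A small calculus of polynomial-time functions (`PolyComputable`), closed under
composition and controlled list folds, supplies the pre- and post-processing, and `exists_reduction`
wraps them around the given algorithm without using further coins. -/

namespace FairClustering

/-! ### Trees as lists -/

namespace Data

/-- The list of trees that a tree encodes. -/
def toList : Data → List Data
  | nil => []
  | node a b => a :: b.toList

/-- Case distinction on being `nil`. -/
def cases : Data → Data → Data → Data
  | nil, _, b => b
  | node _ _, a, _ => a

@[simp] theorem toList_nil : nil.toList = [] := rfl

@[simp] theorem toList_node (a b : Data) : (node a b).toList = a :: b.toList := rfl

@[simp] theorem head_nil : nil.head = nil := rfl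

@[simp] theorem head_node (a b : Data) : (node a b).head = a := rfl

@[simp] theorem tail_nil : nil.tail = nil := rfl

@[simp] theorem tail_node (a b : Data) : (node a b).tail = b := rfl

@[simp] theorem cases_nil (a b : Data) : cases nil a b = b := rfl

@[simp] theorem cases_node (x y a b : Data) : cases (node x y) a b = a := rfl

@[simp] theorem toList_ofList (l : List Data) : (ofList l).toList = l := by
  induction l with
  | nil => rfl
  | cons a l ih => simp [ofList, ih]

@[simp] theorem ofList_toList (x : Data) : ofList x.toList = x := by
  induction x with
  | nil => rfl
  | node a b _ ih => simp [ofList, ih]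

@[simp] theorem toList_tail (x : Data) : x.tail.toList = x.toList.tail := by
  cases x <;> rfl

@[simp] theorem toList_eq_nil_iff (x : Data) : x.toList = [] ↔ x = nil := by
  cases x <;> simp

theorem ofBool_true : ofBool true = node nil nil := rfl

theorem ofBool_false : ofBool false = nil := rfl

@[simp] theorem size_nil : nil.size = 1 := rfl

@[simp] theorem size_node (a b : Data) : (node a b).size = 1 + a.size + b.size := rfl

theorem size_pos (x : Data) : 1 ≤ x.size := by
  cases x <;> simp; omega

theorem size_head_le (x : Data) : x.head.size ≤ x.size := by
  cases x <;> simp; omega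

theorem size_tail_le (x : Data) : x.tail.size ≤ x.size := by
  cases x <;> simp

theorem size_cases_le (x a b : Data) : (cases x a b).size ≤ max a.size b.size := by
  cases x <;> simp

/-- The `+ 1` accounts for the terminating `nil`, which two separate lists contain twice. -/
theorem size_ofList_append (l l' : List Data) :
    (ofList (l ++ l')).size + 1 = (ofList l).size + (ofList l').size := by
  induction l with
  | nil => simp [ofList]; omega
  | cons a l ih => simp [ofList] at *; omega

theorem length_lt_size (x : Data) : x.toList.length < x.size := by
  induction x with
  | nil => simp
  | node a b _ ih => simp; omega

theorem size_le_of_mem_toList {x h : Data} (hh : h ∈ x.toList) : h.size + 2 ≤ x.size := by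
  induction x with
  | nil => simp at hh
  | node a b _ ih =>
    rcases List.mem_cons.1 hh with rfl | hh
    · have := b.size_pos
      simp; omega
    · have := ih hh
      simp; omega

end Data

theorem eval_mono (P : Polynomial ℕ) {a b : ℕ} (h : a ≤ b) : P.eval a ≤ P.eval b := by
  rw [Polynomial.eval_eq_sum_range, Polynomial.eval_eq_sum_range]
  gcongr

/-- An assignment pays for the tree it stores, while a toss stores up to three vertices for one
step; hence the factor `3`. Running time thus bounds output size, which makes compositions
polynomial. -/
theorem Run.size_le {c : Program} {st st' : State} {t : ℕ} (h : Run c st st' t) :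
    ∀ B, (∀ i, (st.store i).size ≤ B) → ∀ i, (st'.store i).size ≤ B + 3 * t := by
  induction h with
  | skip st => intro B hB i; have := hB i; omega
  | assign x e st =>
    intro B hB i
    by_cases hi : i = x
    · subst hi; simp; omega
    · have := hB i
      simp [hi]; omega
  | toss x st =>
    intro B hB i
    by_cases hi : i = x
    · subst hi
      cases st.coins 0 <;> simp [Data.ofBool]
    · have := hB i
      simp [hi]; omega
  | seq _ _ ih1 ih2 => intro B hB i; have := ih2 _ (ih1 _ hB) i; omega
  | branch_true _ _ ih => intro B hB i; have := ih _ hB i; omega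
  | branch_false _ _ ih => intro B hB i; have := ih _ hB i; omega
  | loop_true _ _ _ ih1 ih2 => intro B hB i; have := ih2 _ (ih1 _ hB) i; omega
  | loop_false _ => intro B hB i; have := hB i; omega

/-! ### Functions computable in polynomial time -/

/-- The deterministic program `c` computes `f` in variable `0`, whatever the other variables hold,
in time `P`, and does not change the variables from `N` on. -/
def Computes (c : Program) (N : ℕ) (P : Polynomial ℕ) (f : Data → Data) : Prop :=
  c.Deterministic ∧ ∀ (σ : Store) (ω : ℕ → Bool), ∃ (σ' : Store) (t : ℕ),
    Run c ⟨σ, ω⟩ ⟨σ', ω⟩ t ∧ σ' 0 = f (σ 0) ∧ (∀ i, N ≤ i → σ' i = σ i) ∧ t ≤ P.eval (σ 0).size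

/-- Functions on trees that are computable in polynomial time. -/
def PolyComputable (f : Data → Data) : Prop :=
  ∃ (c : Program) (N : ℕ) (P : Polynomial ℕ), Computes c N P f

theorem Computes.mono {c : Program} {N N' : ℕ} {P : Polynomial ℕ} {f : Data → Data}
    (h : Computes c N P f) (hN : N ≤ N') : Computes c N' P f := by
  refine ⟨h.1, fun σ ω => ?_⟩
  obtain ⟨σ', t, h1, h2, h3, h4⟩ := h.2 σ ω
  exact ⟨σ', t, h1, h2, fun i hi => h3 i (hN.trans hi), h4⟩

namespace PolyComputable

open Data

theorem size_le {f : Data → Data} (h : PolyComputable f) :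
    ∃ Q : Polynomial ℕ, ∀ x, (f x).size ≤ Q.eval x.size := by
  obtain ⟨c, N, P, h⟩ := h
  refine ⟨Polynomial.X + 3 * P, fun x => ?_⟩
  obtain ⟨σ', t, h1, h2, -, h4⟩ := h.2 (fun _ => x) (fun _ => false)
  have := h1.size_le x.size (fun _ => le_rfl) 0
  simp only [h2] at this
  simp at h4 ⊢
  omega

theorem of_assign {f : Data → Data} (e : Expr) (he : ∀ σ, e.eval σ = f (σ 0)) (P : Polynomial ℕ)
    (hP : ∀ x, (f x).size ≤ P.eval x.size) : PolyComputable f := by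
  refine ⟨.assign 0 e, 1, 1 + P, trivial, fun σ ω => ⟨_, _, Run.assign 0 e ⟨σ, ω⟩, ?_, ?_, ?_⟩⟩
  · simp [he]
  · intro i hi
    simp [show i ≠ 0 by omega]
  · simp [he, hP]

theorem id : PolyComputable fun x => x :=
  of_assign (.var 0) (fun _ => rfl) Polynomial.X (by simp)

/-- A closed expression for a tree. -/
def _root_.FairClustering.Data.toExpr : Data → Expr
  | .nil => .nil
  | .node a b => .node a.toExpr b.toExpr

theorem _root_.FairClustering.Data.eval_toExpr (d : Data) (σ : Store) : d.toExpr.eval σ = d := by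
  induction d with
  | nil => rfl
  | node a b iha ihb => simp [toExpr, Expr.eval, iha, ihb]

theorem const (d : Data) : PolyComputable fun _ => d :=
  of_assign d.toExpr (fun σ => d.eval_toExpr σ) (Polynomial.C d.size) (by simp)

theorem comp {f g : Data → Data} (hf : PolyComputable f) (hg : PolyComputable g) :
    PolyComputable fun x => f (g x) := by
  obtain ⟨Q, hQ⟩ := hg.size_le
  obtain ⟨c, N, P, h⟩ := hf
  obtain ⟨c', N', P', h'⟩ := hg
  refine ⟨.seq c' c, max N N', P' + P.comp Q, ⟨h'.1, h.1⟩, fun σ ω => ?_⟩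
  obtain ⟨σ₁, t₁, a1, a2, a3, a4⟩ := h'.2 σ ω
  obtain ⟨σ₂, t₂, b1, b2, b3, b4⟩ := h.2 σ₁ ω
  refine ⟨σ₂, _, a1.seq b1, by rw [b2, a2], fun i hi => ?_, ?_⟩
  · rw [b3 i (le_trans (le_max_left _ _) hi), a3 i (le_trans (le_max_right _ _) hi)]
  · rw [a2] at b4
    simp only [Polynomial.eval_add, Polynomial.eval_comp]
    exact add_le_add a4 (b4.trans (eval_mono _ (hQ _)))

theorem head {f : Data → Data} (hf : PolyComputable f) : PolyComputable fun x => (f x).head :=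
  (of_assign (.head (.var 0)) (fun _ => rfl) Polynomial.X
    (by simpa using size_head_le) : PolyComputable Data.head).comp hf

theorem tail {f : Data → Data} (hf : PolyComputable f) : PolyComputable fun x => (f x).tail :=
  (of_assign (.tail (.var 0)) (fun _ => rfl) Polynomial.X
    (by simpa using size_tail_le) : PolyComputable Data.tail).comp hf

theorem node {f g : Data → Data} (hf : PolyComputable f) (hg : PolyComputable g) :
    PolyComputable fun x => Data.node (f x) (g x) := by
  obtain ⟨Q, hQ⟩ := hf.size_le
  obtain ⟨R, hR⟩ := hg.size_le
  obtain ⟨c, N, P, h⟩ := hf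
  obtain ⟨c', N', P', h'⟩ := hg
  obtain ⟨M, h1M, hNM, hN'M⟩ : ∃ M, 1 ≤ M ∧ N ≤ M ∧ N' ≤ M :=
    ⟨max 1 (max N N'), by omega, by omega, by omega⟩
  replace h := h.mono hNM
  replace h' := h'.mono hN'M
  -- Neither program touches the variables from `M` on: `M` keeps the input for the second call and
  -- `M + 1` keeps the first result.
  refine ⟨.seq (.assign M (.var 0)) (.seq c (.seq (.assign (M + 1) (.var 0))
    (.seq (.assign 0 (.var M)) (.seq c' (.assign 0 (.node (.var (M + 1)) (.var 0))))))), M + 2,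
    (1 + Polynomial.X) + (P + ((1 + Q) + ((1 + Polynomial.X) + (P' + (1 + (1 + Q + R)))))),
    ⟨trivial, h.1, trivial, trivial, h'.1, trivial⟩, fun σ ω => ?_⟩
  have r1 := Run.assign M (.var 0) ⟨σ, ω⟩
  obtain ⟨σ₂, t₂, r2, e2, k2, l2⟩ := h.2 (Function.update σ M (σ 0)) ω
  have r3 := Run.assign (M + 1) (.var 0) ⟨σ₂, ω⟩
  have r4 := Run.assign 0 (.var M) ⟨Function.update σ₂ (M + 1) (σ₂ 0), ω⟩
  obtain ⟨σ₅, t₅, r5, e5, k5, l5⟩ :=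
    h'.2 (Function.update (Function.update σ₂ (M + 1) (σ₂ 0)) 0 (σ₂ M)) ω
  have r6 := Run.assign 0 (.node (.var (M + 1)) (.var 0)) ⟨σ₅, ω⟩
  have hM0 : M ≠ 0 := by omega
  have hx : σ₂ M = σ 0 := by simp [k2 M le_rfl]
  have hf : σ₂ 0 = f (σ 0) := by simp [e2, hM0.symm]
  have hg : σ₅ 0 = g (σ 0) := by simp [e5, hx]
  have hf' : σ₅ (M + 1) = f (σ 0) := by simp [k5 (M + 1) (by omega), hf]
  simp only [Expr.eval] at r3 r4 r6
  rw [Function.update_of_ne (by omega)] at r4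
  refine ⟨_, _, r1.seq (r2.seq (r3.seq (r4.seq (r5.seq r6)))), ?_, ?_, ?_⟩
  · simp [hf', hg]
  · intro i hi
    rw [Function.update_of_ne (by omega), k5 i (by omega), Function.update_of_ne (by omega),
      Function.update_of_ne (by omega), k2 i (by omega), Function.update_of_ne (by omega)]
  · simp only [Polynomial.eval_add, Polynomial.eval_one, Polynomial.eval_X]
    rw [Function.update_of_ne hM0.symm] at l2
    rw [Function.update_self, hx] at l5
    have := hQ (σ 0)
    have := hR (σ 0)
    simp only [Expr.eval, hx, hf, hg, hf', size_node]
    omega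

theorem cases {h f g : Data → Data} (hh : PolyComputable h) (hf : PolyComputable f)
    (hg : PolyComputable g) : PolyComputable fun x => Data.cases (h x) (f x) (g x) := by
  obtain ⟨c₀, N₀, P₀, h₀⟩ := hh
  obtain ⟨c, N, P, h₁⟩ := hf
  obtain ⟨c', N', P', h₂⟩ := hg
  obtain ⟨M, h1M, hN₀M, hNM, hN'M⟩ : ∃ M, 1 ≤ M ∧ N₀ ≤ M ∧ N ≤ M ∧ N' ≤ M :=
    ⟨max (max 1 N₀) (max N N'), by omega, by omega, by omega, by omega⟩
  replace h₀ := h₀.mono hN₀M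
  replace h₁ := h₁.mono hNM
  replace h₂ := h₂.mono hN'M
  have hM0 : M ≠ 0 := by omega
  refine ⟨.seq (.assign M (.var 0)) (.seq c₀ (.branch (.var 0) (.seq (.assign 0 (.var M)) c)
    (.seq (.assign 0 (.var M)) c'))), M + 1,
    (1 + Polynomial.X) + (P₀ + (1 + ((1 + Polynomial.X) + (P + P')))),
    ⟨trivial, h₀.1, ⟨trivial, h₁.1⟩, ⟨trivial, h₂.1⟩⟩, fun σ ω => ?_⟩
  have r1 := Run.assign M (.var 0) ⟨σ, ω⟩
  obtain ⟨σ₂, t₂, r2, e2, k2, l2⟩ := h₀.2 (Function.update σ M (σ 0)) ω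
  have r3 := Run.assign 0 (.var M) ⟨σ₂, ω⟩
  have hx : σ₂ M = σ 0 := by simp [k2 M le_rfl]
  have hh : σ₂ 0 = h (σ 0) := by simp [e2, hM0.symm]
  rw [Function.update_of_ne hM0.symm] at l2
  simp only [Expr.eval, hx] at r3
  by_cases hz : σ₂ 0 = Data.nil
  · obtain ⟨σ₄, t₄, r4, e4, k4, l4⟩ := h₂.2 (Function.update σ₂ 0 (σ 0)) ω
    refine ⟨_, _, r1.seq (r2.seq (Run.branch_false hz (r3.seq r4))), ?_, ?_, ?_⟩
    · change _ = Data.cases (h (σ 0)) _ _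
      rw [← hh, hz]; simp [e4]
    · intro i hi
      rw [k4 i (by omega), Function.update_of_ne (by omega), k2 i (by omega),
        Function.update_of_ne (by omega)]
    · simp only [Polynomial.eval_add, Polynomial.eval_one, Polynomial.eval_X, Expr.eval]
      rw [Function.update_self] at l4
      omega
  · obtain ⟨σ₄, t₄, r4, e4, k4, l4⟩ := h₁.2 (Function.update σ₂ 0 (σ 0)) ω
    refine ⟨_, _, r1.seq (r2.seq (Run.branch_true hz (r3.seq r4))), ?_, ?_, ?_⟩
    · change _ = Data.cases (h (σ 0)) _ _
      rw [← hh]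
      cases hs : σ₂ 0 with
      | nil => exact absurd hs hz
      | node a b => simp [e4]
    · intro i hi
      rw [k4 i (by omega), Function.update_of_ne (by omega), k2 i (by omega),
        Function.update_of_ne (by omega)]
    · simp only [Polynomial.eval_add, Polynomial.eval_one, Polynomial.eval_X, Expr.eval]
      rw [Function.update_self] at l4
      omega

/-- The body of a loop that folds the program `c` over the list in variable `N + 1`, with context
in variable `N` and accumulator in variable `N + 2`. -/
def foldBody (c : Program) (N : ℕ) : Program :=
  .seq (.assign 0 (.node (.var N) (.node (.head (.var (N + 1))) (.var (N + 2))))) (.seq c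
    (.seq (.assign (N + 2) (.var 0)) (.assign (N + 1) (.tail (.var (N + 1))))))

/-- The accumulators met during the loop are the folds over prefixes of `l`, so a bound `B` on
those, together with a bound `S` on context and list, bounds the cost of every round uniformly. -/
theorem run_fold_loop {c : Program} {N : ℕ} {P : Polynomial ℕ} {g : Data → Data → Data → Data}
    (h : Computes c N P fun x => g x.head x.tail.head x.tail.tail) (hN : 1 ≤ N) (S B : ℕ)
    (ω : ℕ → Bool) (l : List Data) : ∀ σ : Store, (σ (N + 1)).toList = l →
      (σ N).size + (σ (N + 1)).size ≤ S →
      (∀ l', l' <+: l → (l'.foldl (fun a y => g (σ N) y a) (σ (N + 2))).size ≤ B) →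
      ∃ (σ' : Store) (t : ℕ), Run (.loop (.var (N + 1)) (foldBody c N)) ⟨σ, ω⟩ ⟨σ', ω⟩ t ∧
        σ' (N + 2) = l.foldl (fun a y => g (σ N) y a) (σ (N + 2)) ∧
        (∀ i, N + 3 ≤ i → σ' i = σ i) ∧
        t ≤ l.length * (P.eval (S + B + 2) + 2 * S + 2 * B + 6) + 1 := by
  induction l with
  | nil =>
    intro σ hl _ _
    exact ⟨σ, 1, Run.loop_false (by simpa [Expr.eval] using hl), rfl, fun _ _ => rfl, by simp⟩
  | cons y l ih =>
    intro σ hl hS hB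
    have hnil : σ (N + 1) ≠ Data.nil := by
      intro h0; simp [h0] at hl
    have hy : (σ (N + 1)).head = y := by
      cases hs : σ (N + 1) with
      | nil => exact absurd hs hnil
      | node a b => simp [hs] at hl; simp [hl]
    have r1 := Run.assign 0 (.node (.var N) (.node (.head (.var (N + 1))) (.var (N + 2)))) ⟨σ, ω⟩
    simp only [Expr.eval, hy] at r1
    obtain ⟨σ₂, t₂, r2, e2, k2, l2⟩ := h.2 (Function.update σ 0
      (Data.node (σ N) (Data.node y (σ (N + 2))))) ω
    have r3 := Run.assign (N + 2) (.var 0) ⟨σ₂, ω⟩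
    have r4 := Run.assign (N + 1) (.tail (.var (N + 1)))
      ⟨Function.update σ₂ (N + 2) (σ₂ 0), ω⟩
    simp only [Expr.eval] at r3 r4
    rw [Function.update_of_ne (by omega)] at r4
    have f1 : σ₂ (N + 1) = σ (N + 1) := by
      rw [k2 _ (by omega), Function.update_of_ne (by omega)]
    have f0 : σ₂ N = σ N := by
      rw [k2 _ (by omega), Function.update_of_ne (by omega)]
    have f2 : σ₂ 0 = g (σ N) y (σ (N + 2)) := by simp [e2]
    rw [f1] at r4
    set σ₄ := Function.update (Function.update σ₂ (N + 2) (σ₂ 0)) (N + 1) (σ (N + 1)).tail with hσ₄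
    have g0 : σ₄ N = σ N := by simp [hσ₄, f0]
    have g1 : σ₄ (N + 1) = (σ (N + 1)).tail := by simp [hσ₄]
    have g2 : σ₄ (N + 2) = g (σ N) y (σ (N + 2)) := by simp [hσ₄, f2]
    have hta := (σ (N + 1)).size_tail_le
    obtain ⟨σ', t', r5, e5, k5, l5⟩ := ih σ₄ (by simp [g1, hl]) (by rw [g0, g1]; omega) (by
      intro l' hl'
      rw [g0, g2]
      simpa using hB (y :: l') (by simpa using hl'))
    refine ⟨σ', _, Run.loop_true (by simpa [Expr.eval] using hnil) (r1.seq (r2.seq (r3.seq r4))) r5,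
      by rw [e5, g0, g2]; rfl, ?_, ?_⟩
    · intro i hi
      rw [k5 i hi, hσ₄, Function.update_of_ne (by omega), Function.update_of_ne (by omega),
        k2 i (by omega), Function.update_of_ne (by omega)]
    · have b0 : (σ (N + 2)).size ≤ B := by simpa using hB [] (by simp)
      have b1 : (σ₂ 0).size ≤ B := by simpa [f2] using hB [y] (by simp)
      have hys := (σ (N + 1)).size_head_le
      rw [hy] at hys
      rw [Function.update_self] at l2
      have hsz : (Data.node (σ N) (Data.node y (σ (N + 2)))).size ≤ S + B + 2 := by
        simp only [size_node]; omega
      have := l2.trans (eval_mono P hsz)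
      simp only [List.length_cons, add_mul, one_mul]
      omega

/-- Iterating a polynomial-time step can blow up the accumulator exponentially, so a polynomial
bound on all intermediate results has to be assumed. -/
theorem fold_of_size_le {g : Data → Data → Data → Data} {c l a : Data → Data}
    (hg : PolyComputable fun x => g x.head x.tail.head x.tail.tail) (hc : PolyComputable c)
    (hl : PolyComputable l) (ha : PolyComputable a)
    (hB : ∃ B : Polynomial ℕ, ∀ c l a l', l' <+: Data.toList l →
      (l'.foldl (fun a y => g c y a) a).size ≤ B.eval (c.size + l.size + a.size)) :
    PolyComputable fun x => (l x).toList.foldl (fun b y => g (c x) y b) (a x) := by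
  -- It suffices to treat an input that is already the triple of context, list and initial
  -- accumulator.
  suffices H : PolyComputable fun x =>
      (x.tail.head.toList.foldl (fun b y => g x.head y b) x.tail.tail) from
    H.comp (hc.node (hl.node ha))
  obtain ⟨B, hB⟩ := hB
  obtain ⟨p, N, P, h⟩ := hg
  have h := h.mono (Nat.le_succ N)
  set M := N.succ with hM
  let X : Polynomial ℕ := Polynomial.X
  let D : Polynomial ℕ := B.comp (3 * X)
  refine ⟨.seq (.assign M (.head (.var 0))) (.seq (.assign (M + 1) (.head (.tail (.var 0))))
    (.seq (.assign (M + 2) (.tail (.tail (.var 0)))) (.seq (.loop (.var (M + 1)) (foldBody p M))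
      (.assign 0 (.var (M + 2)))))), M + 3,
    (1 + X) + ((1 + X) + ((1 + X) + ((X * (P.comp (2 * X + D + 2) + 2 * (2 * X) + 2 * D + 6) + 1) +
      (1 + D)))),
    ⟨trivial, trivial, trivial, ⟨trivial, h.1, trivial, trivial⟩, trivial⟩, fun σ ω => ?_⟩
  have hM0 : M ≠ 0 := by omega
  set x := σ 0 with hx
  have r1 := Run.assign M (.head (.var 0)) ⟨σ, ω⟩
  simp only [Expr.eval, ← hx] at r1
  have r2 := Run.assign (M + 1) (.head (.tail (.var 0))) ⟨Function.update σ M x.head, ω⟩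
  simp only [Expr.eval] at r2
  rw [Function.update_of_ne (by omega), ← hx] at r2
  have r3 := Run.assign (M + 2) (.tail (.tail (.var 0)))
    ⟨Function.update (Function.update σ M x.head) (M + 1) x.tail.head, ω⟩
  simp only [Expr.eval] at r3
  rw [Function.update_of_ne (by omega), Function.update_of_ne (by omega), ← hx] at r3
  set σ₃ := Function.update (Function.update (Function.update σ M x.head) (M + 1) x.tail.head)
    (M + 2) x.tail.tail with hσ₃
  have g0 : σ₃ M = x.head := by simp [hσ₃]
  have g1 : σ₃ (M + 1) = x.tail.head := by simp [hσ₃]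
  have g2 : σ₃ (M + 2) = x.tail.tail := by simp [hσ₃]
  have s0 := x.size_head_le
  have s1 := x.size_tail_le
  have s2 := x.tail.size_head_le
  have s3 := x.tail.size_tail_le
  have hB' : ∀ l', l' <+: x.tail.head.toList →
      (l'.foldl (fun a y => g x.head y a) x.tail.tail).size ≤ D.eval x.size := by
    intro l' hl'
    refine (hB _ _ _ _ hl').trans ?_
    simp only [D, X, Polynomial.eval_comp, Polynomial.eval_mul, Polynomial.eval_X,
      Polynomial.eval_ofNat]
    exact eval_mono _ (by omega)
  obtain ⟨σ₄, t₄, r4, e4, k4, l4⟩ := run_fold_loop h (by omega) (2 * x.size) (D.eval x.size) ω _ σ₃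
    rfl (by rw [g0, g1]; omega) (by rw [g0, g1, g2]; exact hB')
  have r5 := Run.assign 0 (.var (M + 2)) ⟨σ₄, ω⟩
  simp only [Expr.eval] at r5
  rw [g0, g1, g2] at e4
  refine ⟨_, _, r1.seq (r2.seq (r3.seq (r4.seq r5))), ?_, ?_, ?_⟩
  · simp [e4]
  · intro i hi
    rw [Function.update_of_ne (by omega), k4 i (by omega), hσ₃, Function.update_of_ne (by omega),
      Function.update_of_ne (by omega), Function.update_of_ne (by omega)]
  · have h5 := hB' _ (List.prefix_refl _)
    rw [← e4] at h5
    have h6 := x.tail.head.length_lt_size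
    rw [g1] at l4
    have h7 : x.tail.head.toList.length * (P.eval (2 * x.size + D.eval x.size + 2) +
        2 * (2 * x.size) + 2 * D.eval x.size + 6) ≤ x.size * (P.eval (2 * x.size + D.eval x.size + 2)
        + 2 * (2 * x.size) + 2 * D.eval x.size + 6) := Nat.mul_le_mul_right _ (by omega)
    simp only [X, Polynomial.eval_comp, Polynomial.eval_mul, Polynomial.eval_X, Polynomial.eval_one,
      Polynomial.eval_ofNat, Polynomial.eval_add] at h7 ⊢
    omega

/-- If one step adds to the accumulator an amount that depends only on the context and the list
entry, the growth is linear in the length of the list and the size hypothesis of `fold_of_size_le`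
is automatic. -/
theorem fold {g : Data → Data → Data → Data} {c l a : Data → Data}
    (hg : PolyComputable fun x => g x.head x.tail.head x.tail.tail) (hc : PolyComputable c)
    (hl : PolyComputable l) (ha : PolyComputable a)
    (hG : ∃ G : Polynomial ℕ, ∀ c y a, (g c y a).size ≤ a.size + G.eval (c.size + y.size)) :
    PolyComputable fun x => (l x).toList.foldl (fun b y => g (c x) y b) (a x) := by
  obtain ⟨G, hG⟩ := hG
  refine fold_of_size_le hg hc hl ha ⟨Polynomial.X + Polynomial.X * G, fun c l a l' hl' => ?_⟩
  have key : ∀ (l' : List Data) (S : ℕ) (a : Data), (∀ y ∈ l', y.size ≤ S) →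
      (l'.foldl (fun a y => g c y a) a).size ≤ a.size + l'.length * G.eval (c.size + S) := by
    intro l' S
    induction l' with
    | nil => simp
    | cons y l' ih =>
      intro a hS
      have h1 := ih (g c y a) fun z hz => hS z (by simp [hz])
      have h2 := hG c y a
      have h3 := eval_mono G (Nat.add_le_add_left (hS y (by simp)) c.size)
      simp only [List.foldl_cons, List.length_cons, add_mul, one_mul]
      omega
  refine (key l' l.size a fun y hy => ?_).trans ?_
  · have := size_le_of_mem_toList (hl'.subset hy)
    omega
  · have h1 := l.length_lt_size
    have h2 := hl'.length_le
    simp only [Polynomial.eval_add, Polynomial.eval_mul, Polynomial.eval_X]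
    exact add_le_add (by omega) (Nat.mul_le_mul (by omega) (eval_mono _ (by omega)))

end PolyComputable

/-! ### Running a program in a larger store -/

/-- A bound on the variables of an expression. -/
def Expr.bound : Expr → ℕ
  | .nil => 0
  | .var x => x + 1
  | .node a b => max a.bound b.bound
  | .head a => a.bound
  | .tail a => a.bound

/-- A bound on the variables of a program. -/
def Program.bound : Program → ℕ
  | .skip => 0
  | .assign x e => max (x + 1) e.bound
  | .toss x => x + 1
  | .seq a b => max a.bound b.bound
  | .branch e a b => max e.bound (max a.bound b.bound)
  | .loop e a => max e.bound a.bound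

theorem Expr.eval_congr {σ τ : Store} {e : Expr} {N : ℕ} (he : e.bound ≤ N)
    (h : ∀ i < N, τ i = σ i) : e.eval τ = e.eval σ := by
  induction e with
  | nil => rfl
  | var x => exact h x he
  | node a b iha ihb =>
    simp only [bound, max_le_iff] at he
    simp [eval, iha he.1, ihb he.2]
  | head a ih => simp [eval, ih he]
  | tail a ih => simp [eval, ih he]

/-- This allows data to be kept in variables above `c.bound` while an arbitrary program `c` runs. -/
theorem Run.frame {c : Program} {st st' : State} {t : ℕ} (h : Run c st st' t) {N : ℕ} :
    c.bound ≤ N → ∀ τ : Store, (∀ i < N, τ i = st.store i) →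
    ∃ τ' : Store, Run c ⟨τ, st.coins⟩ ⟨τ', st'.coins⟩ t ∧ (∀ i < N, τ' i = st'.store i) ∧
      ∀ i, N ≤ i → τ' i = τ i := by
  induction h with
  | skip st => exact fun _ τ hτ => ⟨τ, Run.skip _, hτ, fun _ _ => rfl⟩
  | assign x e st =>
    intro hN τ hτ
    simp only [Program.bound, max_le_iff] at hN
    have he := Expr.eval_congr hN.2 hτ
    have r := Run.assign x e ⟨τ, st.coins⟩
    simp only [he] at r
    refine ⟨_, r, fun i hi => ?_, fun i hi => Function.update_of_ne (by omega) _ _⟩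
    by_cases hix : i = x
    · subst hix; simp
    · simp [hix, hτ i hi]
  | toss x st =>
    intro hN τ hτ
    simp only [Program.bound] at hN
    refine ⟨_, Run.toss x ⟨τ, st.coins⟩, fun i hi => ?_,
      fun i hi => Function.update_of_ne (by omega) _ _⟩
    by_cases hix : i = x
    · subst hix; simp
    · simp [hix, hτ i hi]
  | seq _ _ ih1 ih2 =>
    intro hN τ hτ
    simp only [Program.bound, max_le_iff] at hN
    obtain ⟨τ₁, r1, a1, b1⟩ := ih1 hN.1 τ hτ
    obtain ⟨τ₂, r2, a2, b2⟩ := ih2 hN.2 τ₁ a1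
    exact ⟨τ₂, r1.seq r2, a2, fun i hi => (b2 i hi).trans (b1 i hi)⟩
  | branch_true he _ ih =>
    intro hN τ hτ
    simp only [Program.bound, max_le_iff] at hN
    obtain ⟨τ₁, r1, a1, b1⟩ := ih hN.2.1 τ hτ
    exact ⟨τ₁, Run.branch_true (by rwa [Expr.eval_congr hN.1 hτ]) r1, a1, b1⟩
  | branch_false he _ ih =>
    intro hN τ hτ
    simp only [Program.bound, max_le_iff] at hN
    obtain ⟨τ₁, r1, a1, b1⟩ := ih hN.2.2 τ hτ
    exact ⟨τ₁, Run.branch_false (by rwa [Expr.eval_congr hN.1 hτ]) r1, a1, b1⟩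
  | loop_true he _ _ ih1 ih2 =>
    intro hN τ hτ
    have hN' := hN
    simp only [Program.bound, max_le_iff] at hN
    obtain ⟨τ₁, r1, a1, b1⟩ := ih1 hN.2 τ hτ
    obtain ⟨τ₂, r2, a2, b2⟩ := ih2 hN' τ₁ a1
    exact ⟨τ₂, Run.loop_true (by rwa [Expr.eval_congr hN.1 hτ]) r1 r2, a2,
      fun i hi => (b2 i hi).trans (b1 i hi)⟩
  | loop_false he =>
    intro hN τ hτ
    simp only [Program.bound, max_le_iff] at hN
    exact ⟨τ, Run.loop_false (by rwa [Expr.eval_congr hN.1 hτ]), hτ, fun _ _ => rfl⟩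

/-- The program that clears the variables `1, …, N`. -/
def clearProgram : ℕ → Program
  | 0 => .skip
  | N + 1 => .seq (clearProgram N) (.assign (N + 1) .nil)

theorem clearProgram_deterministic (N : ℕ) : (clearProgram N).Deterministic := by
  induction N with
  | zero => trivial
  | succ N ih => exact ⟨ih, trivial⟩

/-- A given algorithm is only specified on initial stores, so the remains of the pre-processing have
to be erased before it is called. -/
theorem run_clearProgram (N : ℕ) (σ : Store) (ω : ℕ → Bool) :
    ∃ σ' : Store, Run (clearProgram N) ⟨σ, ω⟩ ⟨σ', ω⟩ (2 * N + 1) ∧ σ' 0 = σ 0 ∧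
      (∀ i, 1 ≤ i → i ≤ N → σ' i = Data.nil) ∧ ∀ i, N < i → σ' i = σ i := by
  induction N with
  | zero => exact ⟨σ, Run.skip _, rfl, fun i h1 h2 => by omega, fun _ _ => rfl⟩
  | succ N ih =>
    obtain ⟨σ₁, r1, h0, h1, h2⟩ := ih
    have r2 := Run.assign (N + 1) .nil ⟨σ₁, ω⟩
    simp only [Expr.eval] at r2
    refine ⟨Function.update σ₁ (N + 1) Data.nil, ?_, by simpa using h0, fun i hi hi' => ?_,
      fun i hi => ?_⟩
    · exact r1.seq r2
    · by_cases hiN : i = N + 1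
      · subst hiN; simp
      · rw [Function.update_of_ne hiN, h1 i hi (by omega)]
    · rw [Function.update_of_ne (by omega), h2 i (by omega)]

/-- Pre-processing, a call of the program `c` if the pre-processed input has a head, and
post-processing of the input together with the output of `c`. -/
theorem exists_reduction (c : Program) {pre post : Data → Data} (hpre : PolyComputable pre)
    (hpost : PolyComputable post) :
    ∃ (d : Program) (P : Polynomial ℕ), (c.Deterministic → d.Deterministic) ∧
      (∀ x ω, (pre x).head = Data.nil →
        ∃ t, HaltsWith d x ω Data.nil t ∧ t ≤ P.eval x.size) ∧
      ∀ x ω y t, (pre x).head ≠ Data.nil → HaltsWith c (pre x) ω y t →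
        ∃ t', HaltsWith d x ω (post (.node x y)) t' ∧ t' ≤ P.eval (x.size + t) := by
  obtain ⟨Q, hQ⟩ := hpre.size_le
  obtain ⟨c₁, N₁, P₁, h₁⟩ := hpre
  obtain ⟨c₂, N₂, P₂, h₂⟩ := hpost
  obtain ⟨M, hM0, hM1, hM2, hMc⟩ : ∃ M, 0 < M ∧ N₁ ≤ M ∧ N₂ ≤ M ∧ c.bound ≤ M :=
    ⟨max (max 1 N₁) (max N₂ c.bound), by omega, by omega, by omega, by omega⟩
  replace h₁ := h₁.mono (hM1.trans (Nat.le_succ M))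
  replace h₂ := h₂.mono (hM2.trans (Nat.le_succ M))
  let X : Polynomial ℕ := Polynomial.X
  -- Variable `M + 1` lies beyond the reach of all three programs and preserves the input for the
  -- post-processing.
  refine ⟨.seq (.assign (M + 1) (.var 0)) (.seq c₁ (.branch (.head (.var 0))
    (.seq (clearProgram M) (.seq c (.seq (.assign 0 (.node (.var (M + 1)) (.var 0))) c₂)))
    (.assign 0 .nil))),
    (1 + X) + (P₁ + (1 + ((2 * Polynomial.C M + 1) + (X + ((1 + (1 + X + (Q + 3 * X))) +
      P₂.comp (1 + X + (Q + 3 * X))))) + 2)),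
    fun hc => ⟨trivial, h₁.1, ⟨clearProgram_deterministic M, hc, trivial, h₂.1⟩, trivial⟩,
    fun x ω hx => ?_, fun x ω y t hx hy => ?_⟩
  · have r1 := Run.assign (M + 1) (.var 0) (initState x ω)
    simp only [Expr.eval, initState, Function.update_self] at r1
    obtain ⟨σ₂, t₂, r2, e2, k2, l2⟩ := h₁.2 (Function.update
      (Function.update (fun _ => Data.nil) 0 x) (M + 1) x) ω
    have r3 := Run.assign 0 .nil ⟨σ₂, ω⟩
    rw [Function.update_of_ne (by omega), Function.update_self] at l2 e2
    refine ⟨_, ⟨_, r1.seq (r2.seq (Run.branch_false (by simp [Expr.eval, e2, hx]) r3)),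
      by simp [Expr.eval]⟩, ?_⟩
    simp only [X, Polynomial.eval_add, Polynomial.eval_one, Polynomial.eval_X,
      Polynomial.eval_ofNat, Expr.eval, Data.size_nil]
    omega
  · have r1 := Run.assign (M + 1) (.var 0) (initState x ω)
    simp only [Expr.eval, initState, Function.update_self] at r1
    obtain ⟨σ₂, t₂, r2, e2, k2, l2⟩ := h₁.2 (Function.update
      (Function.update (fun _ => Data.nil) 0 x) (M + 1) x) ω
    rw [Function.update_of_ne (by omega), Function.update_self] at l2 e2
    obtain ⟨σ₃, r3, z0, z1, z2⟩ := run_clearProgram M σ₂ ω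
    obtain ⟨st, hst, hsy⟩ := hy
    have hys : y.size ≤ Q.eval x.size + 3 * t := by
      rw [← hsy]
      refine hst.size_le _ (fun i => ?_) 0
      by_cases hi : i = 0
      · subst hi; simpa [initState] using hQ x
      · simp only [initState, Function.update_of_ne hi, Data.size_nil]
        exact (Data.size_pos _).trans (hQ x)
    obtain ⟨σ₄, r4, a4, b4⟩ := hst.frame (N := M) hMc σ₃ (by
      intro i hi
      by_cases hi0 : i = 0
      · subst hi0; simp [initState, z0, e2]
      · simp [initState, hi0, z1 i (by omega) (by omega)])
    have r5 := Run.assign 0 (.node (.var (M + 1)) (.var 0)) ⟨σ₄, st.coins⟩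
    have hx4 : σ₄ (M + 1) = x := by
      rw [b4 _ (by omega), z2 _ (by omega), k2 _ le_rfl, Function.update_self]
    have hy4 : σ₄ 0 = y := by rw [a4 0 hM0, hsy]
    simp only [Expr.eval, hx4, hy4] at r5
    obtain ⟨σ₆, t₆, r6, e6, k6, l6⟩ := h₂.2 (Function.update σ₄ 0 (.node x y)) st.coins
    rw [Function.update_self] at e6 l6
    refine ⟨_, ⟨_, r1.seq (r2.seq (Run.branch_true (by simpa [Expr.eval, e2] using hx)
      (r3.seq (r4.seq (r5.seq r6))))), e6⟩, ?_⟩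
    have m1 := eval_mono P₁ (Nat.le_add_right x.size t)
    have m2 := eval_mono Q (Nat.le_add_right x.size t)
    have m3 : P₂.eval (Data.node x y).size ≤
        P₂.eval (1 + (x.size + t) + (Q.eval (x.size + t) + 3 * (x.size + t))) :=
      eval_mono P₂ (by simp only [Data.size_node]; omega)
    simp only [X, Polynomial.eval_add, Polynomial.eval_one, Polynomial.eval_X, Polynomial.eval_C,
      Polynomial.eval_mul, Polynomial.eval_comp, Polynomial.eval_ofNat, Data.size_node]
    omega

end FairClustering

namespace FairClustering

/-! ### List operations in polynomial time -/

namespace PolyComputable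

open Data

theorem reverse {l : Data → Data} (hl : PolyComputable l) :
    PolyComputable fun x => ofList (l x).toList.reverse := by
  have key : ∀ (l : List Data) (a : Data),
      l.foldl (fun a y => Data.node y a) a = ofList (l.reverse ++ a.toList) := by
    intro l
    induction l with
    | nil => simp
    | cons y l ih => intro a; simp [ih]
  have := fold (g := fun _ y a => .node y a) (id.tail.head.node id.tail.tail) (const .nil) hl
    (const .nil) ⟨Polynomial.X, fun c y a => by simp; have := c.size_pos; omega⟩
  simpa only [key, toList_nil, List.append_nil] using this

/-- A fold that pushes the images onto the accumulator yields the reversed list, which is then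
reversed. -/
theorem map {f : Data → Data → Data} {c l : Data → Data}
    (hf : PolyComputable fun x => f x.head x.tail) (hc : PolyComputable c)
    (hl : PolyComputable l) : PolyComputable fun x => ofList ((l x).toList.map (f (c x))) := by
  have key : ∀ (c : Data) (l : List Data) (a : Data),
      l.foldl (fun a y => Data.node (f c y) a) a = ofList ((l.map (f c)).reverse ++ a.toList) := by
    intro c l
    induction l with
    | nil => simp
    | cons y l ih => intro a; simp [ih]
  obtain ⟨Q, hQ⟩ := hf.size_le
  have := (fold (g := fun c y a => .node (f c y) a)
    ((hf.comp (id.head.node id.tail.head)).node id.tail.tail) hc hl (const .nil)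
    ⟨1 + Q.comp (1 + Polynomial.X), fun c y a => by
      have := hQ (.node c y)
      simp [← add_assoc] at this ⊢; omega⟩).reverse
  simpa only [key, toList_nil, List.append_nil, toList_ofList, List.reverse_reverse] using this

theorem drop {s l : Data → Data} (hs : PolyComputable s) (hl : PolyComputable l) :
    PolyComputable fun x => ofList ((l x).toList.drop (s x).toList.length) := by
  have key : ∀ (l : List Data) (a : Data),
      l.foldl (fun a _ => a.tail) a = ofList (a.toList.drop l.length) := by
    intro l
    induction l with
    | nil => simp
    | cons y l ih => intro a; simp [ih]
  have := fold (g := fun _ _ a => a.tail) id.tail.tail.tail (const .nil) hs hl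
    ⟨0, fun c y a => by simpa using a.size_tail_le⟩
  simpa only [key] using this

end PolyComputable

namespace Data

theorem size_ofList_drop_le (l : List Data) (k : ℕ) : (ofList (l.drop k)).size ≤ (ofList l).size := by
  have := size_ofList_append (l.take k) (l.drop k)
  rw [List.take_append_drop] at this
  have := (ofList (l.take k)).size_pos
  omega

/-- Disjunction of two lists of truth values, as long as the first one. -/
def zipOr : Data → Data → Data
  | nil, _ => nil
  | node a l, b => node (cases a (ofBool true) (cases b.head (ofBool true) nil)) (zipOr l b.tail)

@[simp] theorem nil_zipOr (b : Data) : zipOr nil b = nil := rfl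

@[simp] theorem node_zipOr (a l b : Data) : zipOr (node a l) b =
    node (cases a (ofBool true) (cases b.head (ofBool true) nil)) (zipOr l b.tail) := rfl

theorem size_zipOr_le (l b : Data) : (zipOr l b).size ≤ 4 * l.size := by
  induction l generalizing b with
  | nil => simp
  | node a l _ ih =>
    have h1 := ih b.tail
    have h2 := size_cases_le a (ofBool true) (cases b.head (ofBool true) nil)
    have h3 := size_cases_le b.head (ofBool true) nil
    simp [ofBool] at h1 h2 h3 ⊢
    omega

end Data

namespace PolyComputable

open Data

theorem zipOr {l b : Data → Data} (hl : PolyComputable l) (hb : PolyComputable b) :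
    PolyComputable fun x => Data.zipOr (l x) (b x) := by
  -- The accumulator is the pair of the unread part of `b` and the output so far in reverse order.
  let g : Data → Data → Data → Data := fun _ y a => Data.node a.head.tail
    (Data.node (Data.cases y (ofBool true) (Data.cases a.head.head (ofBool true) .nil)) a.tail)
  have key : ∀ l b o : Data, l.toList.foldl (fun a y => g .nil y a) (Data.node b o) =
      Data.node (b.toList.drop l.toList.length |> ofList)
        (ofList ((Data.zipOr l b).toList.reverse ++ o.toList)) := by
    intro l
    induction l with
    | nil => simp
    | node a l _ ih => intro b o; simp [ih, g]
  have hg : PolyComputable fun x => g x.head x.tail.head x.tail.tail :=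
    id.tail.tail.head.tail.node ((id.tail.head.cases (const _)
      (id.tail.tail.head.head.cases (const _) (const _))).node id.tail.tail.tail)
  have := (fold hg (const .nil) hl (hb.node (const .nil)) ⟨6, fun c y a => by
    have h2 := size_cases_le y (ofBool true) (Data.cases a.head.head (ofBool true) .nil)
    have h3 := size_cases_le a.head.head (ofBool true) .nil
    cases a with
    | nil => simp [g, ofBool] at h2 h3 ⊢; omega
    | node a a' =>
      have h4 := a.size_tail_le
      simp [g, ofBool] at h2 h3 ⊢; omega⟩).tail.reverse
  simpa only [key, tail_node, toList_nil, List.append_nil, toList_ofList, List.reverse_reverse,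
    ofList_toList] using this

end PolyComputable

/-! ### The instance of fair clustering -/

/-- The matrix with `a` on the diagonal and `b` elsewhere, row by row. -/
def diagonalMatrix (a b : Data) (m : ℕ) : Data :=
  Data.ofList ((List.finRange m).map fun i =>
    Data.ofList ((List.finRange m).map fun j => if i = j then a else b))

/-- A new first row and first column are added, so the matrix can be built by a fold without
comparing indices. -/
theorem diagonalMatrix_succ (a b : Data) (m : ℕ) : diagonalMatrix a b (m + 1) =
    .node (.node a (.ofList ((diagonalMatrix a b m).toList.map fun _ => b)))
      (.ofList ((diagonalMatrix a b m).toList.map fun r => .node b r)) := by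
  simp [diagonalMatrix, List.finRange_succ, Data.ofList, Function.comp_def, Fin.succ_ne_zero,
    (Fin.succ_ne_zero _).symm]

theorem Data.size_ofList_const (l : List Data) (b : Data) :
    (ofList (l.map fun _ => b)).size = 1 + l.length * (1 + b.size) := by
  induction l with
  | nil => simp [ofList]
  | cons y l ih => rw [List.map_cons, ofList, size_node, ih]; simp; ring

theorem Data.size_ofList_cons (l : List Data) (b : Data) :
    (ofList (l.map fun r => node b r)).size = (ofList l).size + l.length * (1 + b.size) := by
  induction l with
  | nil => simp [ofList]
  | cons y l ih => simp [ofList, ih]; ring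

theorem PolyComputable.diagonalMatrix (a b : Data) {l : Data → Data} (hl : PolyComputable l) :
    PolyComputable fun x => diagonalMatrix a b (l x).toList.length := by
  let g : Data → Data → Data → Data := fun _ _ o =>
    .node (.node a (.ofList (o.toList.map fun _ => b))) (.ofList (o.toList.map fun r => .node b r))
  have key : ∀ (l : List Data) (k : ℕ), l.foldl (fun o y => g .nil y o)
      (FairClustering.diagonalMatrix a b k) =
      FairClustering.diagonalMatrix a b (l.length + k) := by
    intro l
    induction l with
    | nil => simp
    | cons y l ih =>
      intro k
      rw [List.foldl_cons, show g .nil y (FairClustering.diagonalMatrix a b k) =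
        FairClustering.diagonalMatrix a b (k + 1) from (diagonalMatrix_succ a b k).symm, ih]
      congr 1
      simp; omega
  -- A step adds an amount proportional to the number of rows already present, so `fold` does not
  -- apply. The number of rows grows by one per step, which gives a quadratic bound.
  have hsize : ∀ (l : List Data) (o : Data), (l.foldl (fun o y => g .nil y o) o).size ≤ o.size +
      l.length * (a.size + 3 + (o.toList.length + l.length) * (2 * (1 + b.size))) := by
    intro l
    induction l with
    | nil => simp
    | cons y l ih =>
      intro o
      have h1 := ih (g .nil y o)
      have h2 : (g .nil y o).toList.length = o.toList.length + 1 := by simp [g]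
      have h3 : (g .nil y o).size =
          o.size + a.size + 3 + o.toList.length * (2 * (1 + b.size)) := by
        simp only [g, Data.size_node, Data.size_ofList_const, Data.size_ofList_cons,
          Data.ofList_toList]
        ring
      rw [h2, h3] at h1
      rw [List.foldl_cons, List.length_cons]
      nlinarith
  have hg : PolyComputable fun x => g x.head x.tail.head x.tail.tail :=
    ((const a).node (map (f := fun _ _ => b) (const b) (const .nil) id.tail.tail)).node
      (map (f := fun _ r => .node b r) ((const b).node id.tail) (const .nil) id.tail.tail)
  have := fold_of_size_le hg (const .nil) hl (const .nil)
    ⟨.X + .X * (.C (a.size + 3) + .X * .C (2 * (1 + b.size))), fun c l o l' hl' => by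
      refine (hsize l' o).trans ?_
      have h1 := hl'.length_le
      have h2 := l.length_lt_size
      have h3 := o.length_lt_size
      simp only [Polynomial.eval_add, Polynomial.eval_mul, Polynomial.eval_X, Polynomial.eval_C]
      exact add_le_add (by omega) (Nat.mul_le_mul (by omega) (Nat.add_le_add_left
        (Nat.mul_le_mul_right _ (by omega)) _))⟩
  have h0 : FairClustering.diagonalMatrix a b 0 = .nil := by
    simp [FairClustering.diagonalMatrix, Data.ofList]
  simp only [h0 ▸ key _ 0, add_zero] at this
  exact this

/-- The truth value `b` as a rational number. -/
def bitWeight (b : Data) : Data := b.cases (Data.ofNNRat 1) (Data.ofNNRat 0)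

/-- The transformation of an input of Min `s`-Union into one of fair clustering. -/
def toClustering (x : Data) : Data :=
  .node (.ofList ((Data.ofList (x.tail.toList.drop x.head.toList.length)).toList.map fun _ => .nil))
    (.node (diagonalMatrix (.ofNNRat 0) (.ofNNRat 1) x.tail.toList.length)
      (.ofList (x.tail.toList.map fun r => .ofList (r.toList.map bitWeight))))

theorem polyComputable_toClustering : PolyComputable toClustering :=
  have hb : PolyComputable fun x => bitWeight x.tail :=
    PolyComputable.id.tail.cases (.const _) (.const _)
  .node (.map (f := fun _ _ => .nil) (.const _) (.const .nil) (.drop (.head .id) (.tail .id)))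
    (.node (.diagonalMatrix _ _ (.tail .id))
      (.map (f := fun _ r => .ofList (r.toList.map bitWeight))
        (.map (f := fun _ b => bitWeight b) hb (.const .nil) (.tail .id)) (.const .nil) (.tail .id)))

/-- The instance of fair clustering for `m` sets and the parameter `s`: a uniform metric, a group
for every element, and `m - s` centers. -/
abbrev clusteringInstance {m n : ℕ} (S : Fin m → Finset (Fin n)) (s : ℕ) (hs : s < m) : Instance where
  m := m
  n := n
  k := m - s
  d i j := if i = j then 0 else 1
  w i j := if i ∈ S j then 1 else 0
  d_eq_zero i j := by split_ifs <;> simp_all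
  d_comm i j := by simp [eq_comm]
  d_triangle i j l := by
    by_cases h1 : i = j
    · simp [h1]
    · by_cases h2 : i = l <;> simp [h1, h2]
  one_le_k := by omega
  k_le_m := by omega

@[simp] theorem toList_ofUnary (k : ℕ) : (Data.ofUnary k).toList = List.replicate k .nil := by
  simp [Data.ofUnary]

/-- Weights are encoded point by point, so the indicator list of a set turns into the weights of its
point entry by entry, without transposition. -/
theorem toClustering_encodeMinUnion {m n : ℕ} (S : Fin m → Finset (Fin n)) (s : ℕ) (hs : s < m) :
    toClustering (encodeMinUnion S s) = (clusteringInstance S s hs).encode := by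
  simp only [toClustering, encodeMinUnion, Instance.encode, Data.head_node, Data.tail_node,
    Data.toList_ofList, toList_ofUnary, List.length_replicate, List.length_map,
    List.length_finRange, List.map_map]
  congr 1
  · simp [Data.ofUnary, -List.map_drop]
  · congr 1
    · simp only [diagonalMatrix]
      congr 2
      funext i
      congr 2
      funext j
      split_ifs <;> rfl
    · simp only [Function.comp_def, Data.ofFinset, Data.toList_ofList,
        List.map_map]
      congr 2
      funext j
      congr 2
      funext i
      by_cases h : i ∈ S j <;> simp [h, Data.ofBool, bitWeight]

/-- The head is the number of centers in unary; the branch in `exists_reduction` tests it to avoid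
calling the algorithm when no center would be left. -/
theorem head_toClustering_encodeMinUnion {m n : ℕ} (S : Fin m → Finset (Fin n)) (s : ℕ) :
    (toClustering (encodeMinUnion S s)).head = .nil ↔ m ≤ s := by
  rw [← Data.toList_eq_nil_iff]
  simp [toClustering, encodeMinUnion]

/-! ### The answer -/

/-- What remains of the list `r` if `k` entries are removed for each true entry of `l`. -/
def removeMultiple (k l r : Data) : Data :=
  l.toList.foldl (fun r b => b.cases (.ofList (r.toList.drop k.toList.length)) r) r

theorem PolyComputable.removeMultiple {k l r : Data → Data} (hk : PolyComputable k)
    (hl : PolyComputable l) (hr : PolyComputable r) :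
    PolyComputable fun x => removeMultiple (k x) (l x) (r x) :=
  fold (g := fun k b r => b.cases (.ofList (r.toList.drop k.toList.length)) r)
    (id.tail.head.cases (drop id.head id.tail.tail) id.tail.tail) hk hl hr
    ⟨0, fun k b r => by
      have h1 := Data.size_cases_le b (.ofList (r.toList.drop k.toList.length)) r
      have h2 := Data.size_ofList_drop_le r.toList k.toList.length
      rw [Data.ofList_toList] at h2
      simp at h1 ⊢
      omega⟩

/-- Products are compared with lengths in unary: the list is exhausted exactly when the product
reaches its length. -/
theorem toList_removeMultiple {n : ℕ} (k r : Data) (T : Finset (Fin n)) :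
    (removeMultiple k (.ofFinset T) r).toList = r.toList.drop (k.toList.length * T.card) := by
  have key : ∀ (l : List (Fin n)) (r : Data),
      ((l.map fun j => Data.ofBool (decide (j ∈ T))).foldl
        (fun r b => b.cases (.ofList (r.toList.drop k.toList.length)) r) r).toList =
      r.toList.drop (k.toList.length * l.countP (· ∈ T)) := by
    intro l
    induction l with
    | nil => simp
    | cons j l ih =>
      intro r
      by_cases hj : j ∈ T
      · simp [hj, ih, Data.ofBool_true, mul_add, add_comm]
      · simp [hj, ih, Data.ofBool_false]
  have hc : (List.finRange n).countP (· ∈ T) = T.card := by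
    rw [List.countP_eq_length_filter, ← List.toFinset_card_of_nodup ((List.nodup_finRange n).filter _)]
    congr 1
    ext; simp
  rw [removeMultiple, Data.ofFinset, Data.toList_ofList, key, hc]

/-- One step of the scan over the sets.  The accumulator consists of the rest of the list of
centers, the rest of the counter, and the union of the sets that are not centers. -/
def scanStep (y a : Data) : Data :=
  .node a.head.tail (a.head.head.cases a.tail
    (.node a.tail.head.tail (y.zipOr a.tail.tail)))

@[simp] theorem scanStep_nil (y z : Data) :
    scanStep y (.node .nil z) = .node .nil (.node z.head.tail (y.zipOr z.tail)) := rfl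

@[simp] theorem scanStep_node_nil (y a z : Data) :
    scanStep y (.node (.node .nil a) z) = .node a (.node z.head.tail (y.zipOr z.tail)) := rfl

@[simp] theorem scanStep_node_node (y b c a z : Data) :
    scanStep y (.node (.node (.node b c) a) z) = .node a z := rfl

/-- The scan over the sets. -/
def scan (l a : Data) : Data := l.toList.foldl (fun a y => scanStep y a) a

theorem PolyComputable.scan {l a : Data → Data} (hl : PolyComputable l) (ha : PolyComputable a) :
    PolyComputable fun x => scan (l x) (a x) :=
  have hg : PolyComputable fun x => scanStep x.tail.head x.tail.tail :=
    id.tail.tail.head.tail.node (id.tail.tail.head.head.cases id.tail.tail.tail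
      (id.tail.tail.tail.head.tail.node (id.tail.head.zipOr id.tail.tail.tail.tail)))
  fold (g := fun _ y a => scanStep y a) hg (const .nil) hl ha
    ⟨4 * Polynomial.X + 4, fun c y a => by
      have h1 := a.head.size_tail_le
      have h2 := Data.size_cases_le a.head.head a.tail
        (.node a.tail.head.tail (y.zipOr a.tail.tail))
      have h3 := a.tail.head.size_tail_le
      have h4 := y.size_zipOr_le a.tail.tail
      have h5 : 1 + a.tail.head.size ≤ a.tail.size + 2 ∧ a.head.size + a.tail.size ≤ a.size + 1 := by
        have h := a.tail.size_head_le
        cases a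
        · simp
        · simp at h ⊢; omega
      simp only [scanStep, Data.size_node] at h2 ⊢
      simp
      omega⟩

/-- The answer for the input `x` of Min `s`-Union and the centers `y`. -/
def answer (x y : Data) : Data :=
  let s := x.head
  let z := (scan x.tail (.node y (.node s .nil))).tail
  -- The additional `.nil` makes the list `n + 1` long, so it is exhausted exactly when `s` times
  -- the size of the set exceeds `n`.
  (x.tail.toList.foldl (fun a r => (removeMultiple s r (.node .nil r)).cases a (.ofBool true)) .nil
    ).cases (.ofBool true)
    -- An empty counter means that at least `s` sets are left out. Something then remains of the `n`
    -- entries of the union exactly when four times its size is below `n`.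
    (z.head.cases .nil ((removeMultiple (.ofUnary 4) z.tail z.tail).cases (.ofBool true) .nil))

theorem polyComputable_answer : PolyComputable fun x => answer x.head x.tail :=
  have hx : PolyComputable fun x => x.head := .head .id
  have hz : PolyComputable fun x =>
      (scan x.head.tail (.node x.tail (.node x.head.head .nil))).tail :=
    .tail (.scan hx.tail (.node (.tail .id) (hx.head.node (.const _))))
  have hg : PolyComputable fun x => (removeMultiple x.head x.tail.head (.node .nil x.tail.head)).cases
      x.tail.tail (.ofBool true) :=
    .cases (.removeMultiple hx (.head (.tail .id)) (.node (.const _) (.head (.tail .id))))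
      (.tail (.tail .id)) (.const _)
  .cases (.fold (g := fun s r a => (removeMultiple s r (.node .nil r)).cases a (.ofBool true))
    hg hx.head hx.tail (.const _) ⟨3, fun s r a => by
      have h := Data.size_cases_le (removeMultiple s r (.node .nil r)) a (.ofBool true)
      simp [Data.ofBool] at h ⊢
      omega⟩) (.const _)
    (.cases hz.head (.const _)
      (.cases (.removeMultiple (.const _) hz.tail hz.tail) (.const _) (.const _)))

/-! ### Correctness of the answer -/

/-- The entries of the list `l` at the positions where the list `y` has a `nil`. -/
def unmarked {α : Type*} : List α → Data → List α
  | [], _ => []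
  | a :: l, .nil => a :: unmarked l .nil
  | a :: l, .node .nil y => a :: unmarked l y
  | _ :: l, .node (.node _ _) y => unmarked l y

theorem unmarked_sublist {α : Type*} (l : List α) (y : Data) : (unmarked l y).Sublist l := by
  fun_induction unmarked l y with
  | case1 => simp
  | case2 a l ih => exact ih.cons_cons a
  | case3 a l y ih => exact ih.cons_cons a
  | case4 a l b c y ih => exact ih.cons a

theorem unmarked_map {α : Type*} (f : α → Bool) (l : List α) :
    unmarked l (.ofList (l.map fun a => .ofBool (f a))) = l.filter fun a => !f a := by
  induction l with
  | nil => rfl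
  | cons a l ih => cases h : f a <;> simp [Data.ofList, Data.ofBool_true, Data.ofBool_false, unmarked, h, ih]

/-- The sets that are not chosen as centers by `y`. -/
def unmarkedSet (m : ℕ) (y : Data) : Finset (Fin m) := (unmarked (List.finRange m) y).toFinset

theorem card_unmarkedSet (m : ℕ) (y : Data) :
    (unmarkedSet m y).card = (unmarked (List.finRange m) y).length :=
  List.toFinset_card_of_nodup ((List.nodup_finRange m).sublist (unmarked_sublist _ _))

theorem unmarkedSet_ofFinset {m : ℕ} (C : Finset (Fin m)) :
    unmarkedSet m (.ofFinset C) = Cᶜ := by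
  ext j
  simp [unmarkedSet, Data.ofFinset, unmarked_map]

theorem zipOr_ofFinset {n : ℕ} (T U : Finset (Fin n)) :
    (Data.ofFinset T).zipOr (.ofFinset U) = .ofFinset (T ∪ U) := by
  simp only [Data.ofFinset, Finset.mem_union]
  induction List.finRange n with
  | nil => rfl
  | cons j l ih =>
    by_cases h1 : j ∈ T <;> by_cases h2 : j ∈ U <;> simp [Data.ofList, Data.ofBool_true, Data.ofBool_false, h1, h2, ih]

theorem zipOr_nil {n : ℕ} (T : Finset (Fin n)) :
    (Data.ofFinset T).zipOr .nil = .ofFinset T := by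
  simp only [Data.ofFinset]
  induction List.finRange n with
  | nil => rfl
  | cons j l ih =>
    by_cases h1 : j ∈ T <;> simp [Data.ofList, Data.ofBool_true, Data.ofBool_false, h1, ih]

theorem scan_ofFinset {m n : ℕ} (S : Fin m → Finset (Fin n)) (l : List (Fin m)) :
    ∀ (y k : Data) (U : Finset (Fin n)),
      (scan (.ofList (l.map fun j => .ofFinset (S j))) (.node y (.node k (.ofFinset U)))).tail =
      .node (.ofList (k.toList.drop (unmarked l y).length))
        (.ofFinset (U ∪ (unmarked l y).toFinset.biUnion S)) := by
  simp only [scan, Data.toList_ofList]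
  induction l with
  | nil => simp [unmarked]
  | cons j l ih =>
    intro y k U
    have h : ∀ V : Finset (Fin n), S j ∪ U ∪ V = U ∪ (S j ∪ V) := fun V => by
      rw [Finset.union_comm (S j), Finset.union_assoc]
    rcases y with _ | ⟨_ | ⟨_, _⟩, y⟩ <;>
      simp [unmarked, ih, zipOr_ofFinset, h]

/-- The scan starts with `nil` in place of an empty set of the right length; the first unmarked set
supplies the `n` entries. Without an unmarked set the value stays `nil`, whence the case
distinction. -/
theorem scan_nil {m n : ℕ} (S : Fin m → Finset (Fin n)) (l : List (Fin m)) :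
    ∀ y k : Data, (scan (.ofList (l.map fun j => .ofFinset (S j))) (.node y (.node k .nil))).tail =
      .node (.ofList (k.toList.drop (unmarked l y).length))
        (if unmarked l y = [] then .nil else .ofFinset ((unmarked l y).toFinset.biUnion S)) := by
  induction l with
  | nil => simp [unmarked, scan]
  | cons j l ih =>
    intro y k
    have h1 := scan_ofFinset S l
    simp only [scan, Data.toList_ofList] at ih h1 ⊢
    rcases y with _ | ⟨_ | ⟨_, _⟩, y⟩ <;>
      simp [unmarked, ih, zipOr_nil, h1]
    congr

/-- The tree `y` is arbitrary because the algorithm may output anything on bad coins, and the answer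
must still be controlled on random inputs. -/
theorem answer_encodeMinUnion {m n : ℕ} (S : Fin m → Finset (Fin n)) (s : ℕ) (hs : 1 ≤ s)
    (y : Data) : answer (encodeMinUnion S s) y = .ofBool (decide ((∃ j, n < s * (S j).card) ∨
      s ≤ (unmarkedSet m y).card ∧ 4 * ((unmarkedSet m y).biUnion S).card < n)) := by
  have hlen : ∀ T : Finset (Fin n), (Data.ofFinset T).toList.length = n := by
    simp [Data.ofFinset]
  have hcases : ∀ (x a b : Data), x.cases a b = if x.toList.length = 0 then b else a := by
    intro x a b; cases x <;> simp
  have hbig : ∀ (l : List (Fin m)) (a : Data), (l.map fun j => Data.ofFinset (S j)).foldl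
      (fun a r => (removeMultiple (.ofUnary s) r (.node .nil r)).cases a (.ofBool true)) a =
      if ∃ j ∈ l, n < s * (S j).card then .ofBool true else a := by
    intro l
    induction l with
    | nil => simp
    | cons j l ih =>
      intro a
      rw [List.map_cons, List.foldl_cons, ih, hcases, toList_removeMultiple]
      by_cases h1 : ∃ j ∈ l, n < s * (S j).card
      · simp [h1]
      · simp only [h1, if_false, List.length_drop, toList_ofUnary, List.length_replicate,
          Data.toList_node, List.length_cons, hlen, List.mem_cons, exists_eq_or_imp, or_false]
        congr 1
        simp; omega
  simp only [answer, encodeMinUnion, Data.head_node, Data.tail_node, Data.toList_ofList, hbig,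
    scan_nil]
  by_cases h1 : ∃ j, n < s * (S j).card
  · simp [h1, Data.ofBool]
  · simp only [h1, false_or, List.mem_finRange, true_and, if_false, Data.cases_nil]
    rw [hcases, card_unmarkedSet]
    by_cases h2 : s ≤ (unmarked (List.finRange m) y).length
    · have h3 : unmarked (List.finRange m) y ≠ [] := by
        intro h; simp [h] at h2; omega
      rw [if_pos (by simp; omega), if_neg h3, hcases, toList_removeMultiple]
      by_cases h4 : 4 * ((unmarkedSet m y).biUnion S).card < n
      · rw [if_neg (by simp [hlen]; unfold unmarkedSet at h4; omega)]
        simp [h2, h4]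
      · rw [if_pos (by simp [hlen]; unfold unmarkedSet at h4; omega)]
        simp [h4, Data.ofBool]
    · rw [if_neg (by simp; omega)]
      simp [h2, Data.ofBool]

end FairClustering

namespace FairClustering

/-! ### The cost of a set of centers -/

section Cost

variable {m n : ℕ} (S : Fin m → Finset (Fin n)) {s : ℕ} (hs : s < m)

/-- The number of sets outside `C` that contain `i`. -/
def uncoveredDegree (C : Finset (Fin m)) (i : Fin n) : ℕ := (Cᶜ.filter fun j => i ∈ S j).card

theorem distTo_clusteringInstance {C : Finset (Fin m)} (hC : C.Nonempty) (j : Fin m) :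
    (clusteringInstance S s hs).distTo j C = if j ∈ C then 0 else 1 := by
  have : Nonempty C := hC.to_subtype
  unfold Instance.distTo
  split_ifs with hj
  · refine le_antisymm ?_ (le_ciInf fun c => NNRat.cast_nonneg _)
    refine (ciInf_le ⟨0, ?_⟩ ⟨j, hj⟩).trans (by simp)
    rintro _ ⟨c, rfl⟩
    exact NNRat.cast_nonneg _
  · have h : ∀ c : C, (((clusteringInstance S s hs).d j c : NNRat) : ℝ) = 1 := by
      intro c
      have : j ≠ c := fun h => hj (h ▸ c.2)
      simp [this]
    simp only [h, ciInf_const]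

theorem groupCost_clusteringInstance {C : Finset (Fin m)} (hC : C.Nonempty) {p : ℝ} (hp : 0 < p)
    (i : Fin n) :
    (clusteringInstance S s hs).groupCost p C i = (uncoveredDegree S C i : ℝ) ^ (1 / p) := by
  unfold Instance.groupCost
  congr 1
  have h : ∀ j : Fin m, (((clusteringInstance S s hs).w i j : NNRat) : ℝ) *
      (clusteringInstance S s hs).distTo j C ^ p = if j ∈ Cᶜ ∧ i ∈ S j then 1 else 0 := by
    intro j
    rw [distTo_clusteringInstance S hs hC]
    by_cases h1 : j ∈ C <;> by_cases h2 : i ∈ S j <;>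
      simp [h1, h2, Real.zero_rpow hp.ne']
  rw [uncoveredDegree, ← Finset.filter_univ_mem Cᶜ, Finset.filter_filter, Finset.card_filter,
    Nat.cast_sum]
  refine Finset.sum_congr rfl fun j _ => ?_
  rw [h]
  simp

theorem cost_rpow_clusteringInstance {C : Finset (Fin m)} (hC : C.Nonempty) {p q : ℝ} (hp : 0 < p)
    (hq : 0 < q) : (clusteringInstance S s hs).cost p q C ^ q =
      ∑ i : Fin n, (uncoveredDegree S C i : ℝ) ^ (q / p) := by
  unfold Instance.cost
  rw [one_div, Real.rpow_inv_rpow _ hq.ne']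
  · refine Finset.sum_congr rfl fun i _ => ?_
    rw [groupCost_clusteringInstance S hs hC hp, ← Real.rpow_mul (by positivity)]
    congr 1
    ring
  · refine Finset.sum_nonneg fun i _ => ?_
    rw [groupCost_clusteringInstance S hs hC hp]
    positivity

/-- An element of the union has degree at least `1`, hence contributes at least `1` for any positive
exponent. -/
theorem card_biUnion_le_cost_rpow {C : Finset (Fin m)} (hC : C.Nonempty) {p q : ℝ} (hp : 0 < p)
    (hq : 0 < q) : ((Cᶜ.biUnion S).card : ℝ) ≤ (clusteringInstance S s hs).cost p q C ^ q := by
  rw [cost_rpow_clusteringInstance S hs hC hp hq, Finset.card_eq_sum_ones, Nat.cast_sum]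
  refine (Finset.sum_le_sum fun i hi => ?_).trans
    (Finset.sum_le_sum_of_subset_of_nonneg (Finset.subset_univ _) fun i _ _ => by positivity)
  obtain ⟨j, hj, hij⟩ := Finset.mem_biUnion.1 hi
  have : 1 ≤ uncoveredDegree S C i :=
    Finset.card_pos.2 ⟨j, Finset.mem_filter.2 ⟨hj, hij⟩⟩
  rw [Nat.cast_one]
  exact Real.one_le_rpow (by exact_mod_cast this) (by positivity)

/-- Degrees vanish outside `T`, and by double counting they sum to at most `B`. Hölder with exponent
`p / q` against the constant `1` on `T` gives the bound. -/
theorem cost_rpow_le {C : Finset (Fin m)} (hC : C.Nonempty) {p q : ℝ} (hq : 0 < q) (hqp : q ≤ p)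
    {T : Finset (Fin n)} (hT : ∀ j ∈ Cᶜ, S j ⊆ T) {B : ℕ} (hB : ∑ j ∈ Cᶜ, (S j).card ≤ B) :
    (clusteringInstance S s hs).cost p q C ^ q ≤ (T.card : ℝ) ^ (1 - q / p) * (B : ℝ) ^ (q / p) := by
  have hp : 0 < p := hq.trans_le hqp
  have hsum : ∑ i ∈ T, uncoveredDegree S C i ≤ B := by
    refine le_trans (le_of_eq ?_) hB
    simp only [uncoveredDegree, Finset.card_filter]
    rw [Finset.sum_comm]
    refine Finset.sum_congr rfl fun j hj => ?_
    rw [← Finset.card_filter, Finset.filter_mem_eq_inter, Finset.inter_eq_right.2 (hT j hj)]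
  rw [cost_rpow_clusteringInstance S hs hC hp hq, ← Finset.sum_subset (Finset.subset_univ T)]
  · have h := Real.inner_le_weight_mul_Lp_of_nonneg T (p := p / q) ((one_le_div hq).2 hqp)
      (fun _ => 1) (fun i => (uncoveredDegree S C i : ℝ) ^ (q / p)) (fun _ => zero_le_one)
      (fun i => by positivity)
    simp only [one_mul, Finset.sum_const, nsmul_eq_mul, mul_one, inv_div] at h
    refine h.trans ?_
    gcongr
    refine le_trans (le_of_eq ?_) (Nat.cast_le.2 hsum)
    rw [Nat.cast_sum]
    refine Finset.sum_congr rfl fun i _ => ?_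
    rw [← Real.rpow_mul (by positivity), div_mul_div_cancel₀ hp.ne', div_self hq.ne',
      Real.rpow_one]
  · intro i _ hi
    have : uncoveredDegree S C i = 0 := by
      refine Finset.card_eq_zero.2 (Finset.filter_eq_empty_iff.2 fun j hj hij => hi (hT j hj hij))
    rw [this, Nat.cast_zero, Real.zero_rpow (by positivity)]

theorem cost_nonneg (I : Instance) (p q : ℝ) (C : Finset (Fin I.m)) : 0 ≤ I.cost p q C := by
  unfold Instance.cost Instance.groupCost Instance.distTo
  refine Real.rpow_nonneg (Finset.sum_nonneg fun i _ => Real.rpow_nonneg (Real.rpow_nonneg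
    (Finset.sum_nonneg fun j _ => mul_nonneg (NNRat.cast_nonneg _) (Real.rpow_nonneg
      (Real.iInf_nonneg fun c => NNRat.cast_nonneg _) _)) _) _) _

/-- The competitor is `Jᶜ`, which leaves out exactly the sets inside `T`; their total size is at
most `n` because each has at most `n / s` elements. -/
theorem card_biUnion_le_of_isApprox {p q ρ f : ℝ} (hq : 0 < q) (hqp : q ≤ p) (hf : 0 ≤ f)
    (hρ : ρ ≤ f) {C : Finset (Fin m)} (hC : (clusteringInstance S s hs).IsApprox p q ρ C)
    {J : Finset (Fin m)} {T : Finset (Fin n)} (hJ : J.card = s) (hJT : ∀ j ∈ J, S j ⊆ T)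
    (hsn : ∀ j, s * (S j).card ≤ n) :
    ((Cᶜ.biUnion S).card : ℝ) ≤ f ^ q * ((T.card : ℝ) ^ (1 - q / p) * (n : ℝ) ^ (q / p)) := by
  obtain ⟨hCk, hle⟩ := hC
  have hk : (clusteringInstance S s hs).k = m - s := rfl
  have hJc : Jᶜ.card = m - s := by rw [Finset.card_compl, hJ, Fintype.card_fin]
  have hne : Jᶜ.Nonempty := Finset.card_pos.1 (by omega)
  have hCne : Finset.Nonempty (α := Fin m) C := Finset.card_pos.1 (by
    have : Finset.card (α := Fin m) C = m - s := hCk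
    omega)
  have h1 := hle Jᶜ hJc
  have h0 := cost_nonneg (clusteringInstance S s hs) p q Jᶜ
  have hsum : ∑ j ∈ Jᶜᶜ, (S j).card ≤ n := by
    rw [compl_compl]
    rcases Nat.eq_zero_or_pos s with rfl | hs0
    · rw [Finset.card_eq_zero.1 hJ]; simp
    · refine (Finset.sum_le_card_nsmul J _ (n / s) fun j _ => ?_).trans ?_
      · rw [Nat.le_div_iff_mul_le hs0, mul_comm]; exact hsn j
      · rw [hJ, smul_eq_mul]; exact Nat.mul_div_le n s
  have h2 := cost_rpow_le S hs hne hq hqp (T := T) (by rwa [compl_compl]) hsum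
  refine (card_biUnion_le_cost_rpow S hs hCne (hq.trans_le hqp) hq).trans ?_
  calc (clusteringInstance S s hs).cost p q C ^ q
      ≤ (f * (clusteringInstance S s hs).cost p q Jᶜ) ^ q :=
        Real.rpow_le_rpow (cost_nonneg _ _ _ _)
          (h1.trans (mul_le_mul_of_nonneg_right hρ h0)) hq.le
    _ = f ^ q * (clusteringInstance S s hs).cost p q Jᶜ ^ q := Real.mul_rpow hf h0
    _ ≤ _ := mul_le_mul_of_nonneg_left h2 (by positivity)

end Cost

/-! ### Dense inputs -/

theorem tendsto_natCast_rpow_mul_log {ε : ℝ} (hε : 0 < ε) :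
    Tendsto (fun m : ℕ => 10 * (m : ℝ) ^ ε * Real.log m) atTop atTop := by
  have h1 := (tendsto_rpow_atTop hε).comp (tendsto_natCast_atTop_atTop (R := ℝ))
  have h2 := Real.tendsto_log_atTop.comp (tendsto_natCast_atTop_atTop (R := ℝ))
  exact (h1.const_mul_atTop (by norm_num : (0 : ℝ) < 10)).atTop_mul_atTop₀ h2

/-- With `a = q / p` and `m^ε = X / (10 ln m)`, the powers of `X` have exponents `(1-δ)(1-a)`,
`δ(1-a)` and `a`, which add up to `1`. What remains is a negative power of `ln m`, and this beats
the constant `4`. -/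
theorem eventually_four_mul_lt_groundSize {p q ε δ : ℝ} (hq : 0 < q) (hqp : q < p) (hε : 0 < ε)
    (hδ0 : 0 ≤ δ) (hδ : δ < 1) :
    ∀ᶠ m : ℕ in atTop, ∀ t u : ℝ, 0 ≤ t →
      t ≤ (10 * (unionParam ε m : ℝ) * Real.log m) ^ δ →
      u ≤ ((m : ℝ) ^ (ε * (1 - δ) * (p - q) / (p * q))) ^ q *
        (t ^ (1 - q / p) * (groundSize ε m : ℝ) ^ (q / p)) →
      4 * u < groundSize ε m := by
  have hp : 0 < p := hq.trans hqp
  have ha0 : 0 < q / p := by positivity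
  have ha1 : q / p < 1 := (div_lt_one hp).2 hqp
  set a := q / p with ha
  have hκ : 0 < (1 - δ) * (1 - a) := mul_pos (by linarith) (by linarith)
  have hlog : Tendsto (fun m : ℕ => Real.log m) atTop atTop :=
    Real.tendsto_log_atTop.comp tendsto_natCast_atTop_atTop
  have hdecay : Tendsto (fun m : ℕ => (10 * Real.log m) ^ (-((1 - δ) * (1 - a)))) atTop (𝓝 0) :=
    (tendsto_rpow_neg_atTop hκ).comp (hlog.const_mul_atTop (by norm_num))
  -- With `1 / 8` one gets `4 u ≤ X / 2`, and `X > 2` makes this smaller than `X - 1`, which is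
  -- below the rounded `groundSize`.
  filter_upwards [hdecay.eventually_le_const (by norm_num : (0 : ℝ) < 1 / 8),
    (tendsto_natCast_rpow_mul_log hε).eventually_gt_atTop 2, hlog.eventually_gt_atTop 0,
    eventually_gt_atTop 0] with m h1 h2 h3 hm t u ht0 ht hu
  set X := 10 * (m : ℝ) ^ ε * Real.log m with hX
  have hm' : (0 : ℝ) < m := by exact_mod_cast hm
  have hXn : (groundSize ε m : ℝ) ≤ X := Nat.floor_le (by positivity)
  have hnX : X - 1 < groundSize ε m := Nat.sub_one_lt_floor _
  have hs : (unionParam ε m : ℝ) ≤ (m : ℝ) ^ ε := Nat.floor_le (by positivity)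
  have hX0 : 0 < X := by linarith
  have htX : t ≤ X ^ δ := by
    refine ht.trans (Real.rpow_le_rpow (by positivity) ?_ hδ0)
    rw [hX]; gcongr
  have hf : ((m : ℝ) ^ (ε * (1 - δ) * (p - q) / (p * q))) ^ q =
      ((m : ℝ) ^ ε) ^ ((1 - δ) * (1 - a)) := by
    rw [← Real.rpow_mul hm'.le, ← Real.rpow_mul hm'.le, ha]
    congr 1
    field_simp
  have hu' : u ≤ ((m : ℝ) ^ ε) ^ ((1 - δ) * (1 - a)) * ((X ^ δ) ^ (1 - a) * X ^ a) := by
    rw [hf] at hu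
    refine hu.trans ?_
    have : 0 ≤ 1 - a := by linarith
    gcongr
  have hme : (m : ℝ) ^ ε = X * (10 * Real.log m)⁻¹ := by
    rw [hX]; field_simp
  have hfin : ((m : ℝ) ^ ε) ^ ((1 - δ) * (1 - a)) * ((X ^ δ) ^ (1 - a) * X ^ a) =
      X * (10 * Real.log m) ^ (-((1 - δ) * (1 - a))) := by
    rw [hme, Real.mul_rpow hX0.le (by positivity), Real.inv_rpow (by positivity),
      ← Real.rpow_neg (by positivity), ← Real.rpow_mul hX0.le, ← Real.rpow_add hX0,
      mul_right_comm, ← Real.rpow_add hX0]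
    congr 1
    convert Real.rpow_one X using 2
    ring
  rw [hfin] at hu'
  nlinarith

/-! ### Random inputs -/

section Random

variable {m r n : ℕ}

/-- Any `s` sets have a union of at least `n / 4` elements. -/
def Spread (s : ℕ) (S : Fin m → Finset (Fin n)) : Prop :=
  ∀ J : Finset (Fin m), s ≤ J.card → n ≤ 4 * (J.biUnion S).card

theorem card_draws_mem (J : Finset (Fin m)) (T : Finset (Fin n)) :
    (Finset.univ.filter fun f : Fin m → Fin r → Fin n => ∀ j ∈ J, ∀ l, f j l ∈ T).card =
      (T.card ^ r) ^ J.card * (n ^ r) ^ (m - J.card) := by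
  have h : (Finset.univ.filter fun f : Fin m → Fin r → Fin n => ∀ j ∈ J, ∀ l, f j l ∈ T) =
      Fintype.piFinset fun j => if j ∈ J then Fintype.piFinset fun _ => T else Finset.univ := by
    ext f
    simp only [Finset.mem_filter, Finset.mem_univ, true_and, Fintype.mem_piFinset]
    refine forall_congr' fun j => ?_
    by_cases hj : j ∈ J <;> simp [hj]
  rw [h, Fintype.card_piFinset]
  have h' : ∀ j, (if j ∈ J then Fintype.piFinset fun _ : Fin r => T else Finset.univ).card =
      if j ∈ J then T.card ^ r else n ^ r := by
    intro j
    split_ifs <;> simp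
  simp only [h']
  rw [Finset.prod_ite, Finset.prod_const, Finset.prod_const, Finset.filter_univ_mem,
    Finset.filter_not, Finset.filter_univ_mem, ← Finset.compl_eq_univ_sdiff, Finset.card_compl,
    Fintype.card_fin]

-- Union bound in integer form: there are at most `m ^ s` families of `s` sets and at most `2 ^ n`
-- sets `T` with `4 |T| < n`, and for each pair all `s * r` draws land in `T` for at most a fraction
-- `4 ^ -(s * r)` of the tables.
open Classical in
theorem card_not_spread_mul_le (s : ℕ) (hs : s ≤ m) :
    (Finset.univ.filter fun f : Fin m → Fin r → Fin n => ¬ Spread s (drawnSets f)).card *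
      4 ^ (s * r) ≤ m ^ s * 2 ^ n * Fintype.card (Fin m → Fin r → Fin n) := by
  set P := (Finset.powersetCard s (Finset.univ : Finset (Fin m))) ×ˢ
    (Finset.univ.filter fun T : Finset (Fin n) => 4 * T.card < n) with hP
  have hsub : (Finset.univ.filter fun f : Fin m → Fin r → Fin n => ¬ Spread s (drawnSets f)) ⊆
      P.biUnion fun x => Finset.univ.filter fun f => ∀ j ∈ x.1, ∀ l, f j l ∈ x.2 := by
    intro f hf
    simp only [Spread, Finset.mem_filter, Finset.mem_univ, true_and, not_forall, not_le] at hf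
    obtain ⟨J, hJ, hJn⟩ := hf
    obtain ⟨J', hJ', rfl⟩ := Finset.exists_subset_card_eq hJ
    refine Finset.mem_biUnion.2 ⟨(J', J.biUnion (drawnSets f)), ?_, ?_⟩
    · simp [hP, hJn]
    · simp only [Finset.mem_filter, Finset.mem_univ, true_and]
      exact fun j hj l => Finset.mem_biUnion.2 ⟨j, hJ' hj, Finset.mem_image_of_mem _ (by simp)⟩
  have hPcard : P.card ≤ m ^ s * 2 ^ n := by
    rw [hP, Finset.card_product, Finset.card_powersetCard, Finset.card_univ, Fintype.card_fin]
    refine Nat.mul_le_mul (Nat.choose_le_pow m s) ((Finset.card_le_univ _).trans (by simp))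
  calc _ ≤ (∑ x ∈ P, (Finset.univ.filter fun f : Fin m → Fin r → Fin n =>
          ∀ j ∈ x.1, ∀ l, f j l ∈ x.2).card) * 4 ^ (s * r) :=
        Nat.mul_le_mul_right _ ((Finset.card_le_card hsub).trans Finset.card_biUnion_le)
    _ = ∑ x ∈ P, (Finset.univ.filter fun f : Fin m → Fin r → Fin n =>
          ∀ j ∈ x.1, ∀ l, f j l ∈ x.2).card * 4 ^ (s * r) := Finset.sum_mul _ _ _
    _ ≤ P.card • Fintype.card (Fin m → Fin r → Fin n) := by
        refine Finset.sum_le_card_nsmul _ _ _ fun x hx => ?_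
        simp only [hP, Finset.mem_product, Finset.mem_powersetCard, Finset.mem_filter] at hx
        rw [card_draws_mem, hx.1.2]
        calc (x.2.card ^ r) ^ s * (n ^ r) ^ (m - s) * 4 ^ (s * r)
            = ((4 * x.2.card) ^ r) ^ s * (n ^ r) ^ (m - s) := by
              rw [mul_pow, mul_pow, ← pow_mul 4, mul_comm r s]; ring
          _ ≤ (n ^ r) ^ s * (n ^ r) ^ (m - s) := by
              gcongr
              exact hx.2.2.le
          _ = _ := by
              rw [← pow_add, Nat.add_sub_cancel' hs]
              simp
    _ ≤ _ := by
        rw [smul_eq_mul]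
        exact Nat.mul_le_mul_right _ hPcard

end Random

/-! ### Asymptotics of the parameters and the probability of answering "random" -/

theorem tendsto_unionParam {ε : ℝ} (hε : 0 < ε) : Tendsto (unionParam ε) atTop atTop :=
  tendsto_nat_floor_atTop.comp ((tendsto_rpow_atTop hε).comp tendsto_natCast_atTop_atTop)

theorem eventually_unionParam_lt {ε : ℝ} (hε : ε < 1) : ∀ᶠ m in atTop, unionParam ε m < m := by
  filter_upwards [eventually_gt_atTop 1] with m hm
  rw [unionParam, Nat.floor_lt (by positivity)]
  conv_rhs => rw [← Real.rpow_one (m : ℝ)]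
  exact Real.rpow_lt_rpow_of_exponent_lt (by exact_mod_cast hm) hε

/-- Consequently drawn sets never trigger the size test of `answer`. -/
theorem unionParam_mul_drawCount_le (ε : ℝ) {m : ℕ} (hm : 1 ≤ m) :
    unionParam ε m * drawCount m ≤ groundSize ε m := by
  have hlog : 0 ≤ Real.log m := Real.log_nonneg (by exact_mod_cast hm)
  refine Nat.le_floor ?_
  push_cast
  calc (unionParam ε m : ℝ) * drawCount m ≤ (m : ℝ) ^ ε * (10 * Real.log m) :=
        mul_le_mul (Nat.floor_le (by positivity)) (Nat.floor_le (by positivity)) (by positivity)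
          (by positivity)
    _ = _ := by ring

/-- After taking logarithms the left side is at most `8 (s + 1) ln m` and the right side at least
`1.38 s (10 ln m - 1)`; the thresholds `s ≥ 10` and `ln m ≥ 1` absorb the rounding. The extra factor
`m` on the left makes the failure probability at most `1 / m`. -/
theorem eventually_mul_pow_le {ε : ℝ} (hε : 0 < ε) : ∀ᶠ m : ℕ in atTop,
    m * (m ^ unionParam ε m * 2 ^ groundSize ε m) ≤ 4 ^ (unionParam ε m * drawCount m) := by
  filter_upwards [(tendsto_unionParam hε).eventually_ge_atTop 10, (Real.tendsto_log_atTop.comp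
    tendsto_natCast_atTop_atTop).eventually_ge_atTop (1 : ℝ), eventually_gt_atTop 0]
    with m hs hlog hm
  simp only [Function.comp_apply] at hlog
  have hm' : (0 : ℝ) < m := by exact_mod_cast hm
  have hs' : (10 : ℝ) ≤ unionParam ε m := by exact_mod_cast hs
  have h1 : (groundSize ε m : ℝ) ≤ 10 * (unionParam ε m + 1) * Real.log m := by
    refine (Nat.floor_le (by positivity)).trans ?_
    gcongr
    exact (Nat.lt_floor_add_one _).le
  have h2 : 10 * Real.log m - 1 ≤ drawCount m := (Nat.sub_one_lt_floor _).le
  have h3 := Real.log_two_gt_d9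
  have h4 := Real.log_two_lt_d9
  have h5 : Real.log 4 = 2 * Real.log 2 := by
    rw [show (4 : ℝ) = 2 ^ 2 by norm_num, Real.log_pow]; norm_num
  suffices H : (m : ℝ) * ((m : ℝ) ^ unionParam ε m * 2 ^ groundSize ε m) ≤
      4 ^ (unionParam ε m * drawCount m) by exact_mod_cast H
  rw [← Real.log_le_log_iff (by positivity) (by positivity), Real.log_mul (by positivity)
    (by positivity), Real.log_mul (by positivity) (by positivity), Real.log_pow, Real.log_pow,
    Real.log_pow, h5]
  push_cast
  set s : ℝ := ((unionParam ε m : ℕ) : ℝ)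
  set x := Real.log m
  have e1 : (groundSize ε m : ℝ) * Real.log 2 ≤ 10 * (s + 1) * x * 0.7 :=
    mul_le_mul h1 (by linarith) (by linarith) (by positivity)
  have e2 : s * (10 * x - 1) * (2 * 0.69) ≤ s * drawCount m * (2 * Real.log 2) := by
    gcongr
    linarith
  nlinarith [mul_nonneg (by linarith : 0 ≤ s - 10) (by linarith : 0 ≤ x - 1)]

theorem measure_coins_le_one (A : Set (ℕ → Bool)) : coinMeasure.real A ≤ 1 := by
  unfold coinMeasure
  exact measureReal_le_one

theorem measure_coins_univ : coinMeasure.real Set.univ = 1 := by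
  unfold coinMeasure
  exact probReal_univ

theorem randomRejectProb_le_one (c : Program) (ε : ℝ) (s : ℕ → ℕ) (m : ℕ) :
    randomRejectProb c ε s m ≤ 1 := by
  unfold randomRejectProb
  refine div_le_one_of_le₀ ?_ (by positivity)
  refine (Finset.sum_le_card_nsmul _ _ 1 fun f _ => measure_coins_le_one _).trans ?_
  simp

/-- Spread tables contribute probability exactly `1` since all coins reject, and all but a fraction
`1 / m` of the tables are spread. -/
theorem tendsto_randomRejectProb {c : Program} {ε : ℝ} (hε : 0 < ε) (hε1 : ε < 1)
    (h : ∀ᶠ m in atTop, ∀ f : Fin m → Fin (drawCount m) → Fin (groundSize ε m),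
      Spread (unionParam ε m) (drawnSets f) →
      ∀ ω, Rejects c (encodeMinUnion (drawnSets f) (unionParam ε m)) ω) :
    Tendsto (randomRejectProb c ε (unionParam ε)) atTop (𝓝 1) := by
  have hlow : Tendsto (fun m : ℕ => 1 - 1 / (m : ℝ)) atTop (𝓝 1) := by
    simpa using (tendsto_const_nhds (x := (1 : ℝ))).sub (tendsto_one_div_atTop_nhds_zero_nat (𝕜 := ℝ))
  refine tendsto_of_tendsto_of_tendsto_of_le_of_le' hlow tendsto_const_nhds ?_
    (Eventually.of_forall fun m => randomRejectProb_le_one _ _ _ _)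
  filter_upwards [h, eventually_mul_pow_le hε, eventually_unionParam_lt hε1, eventually_gt_atTop 0,
    (tendsto_natCast_rpow_mul_log hε).eventually_ge_atTop 1] with m hrej hpow hsm hm hn
  classical
  have hn' : 0 < groundSize ε m := Nat.floor_pos.2 hn
  have : NeZero (groundSize ε m) := ⟨hn'.ne'⟩
  set F := Fin m → Fin (drawCount m) → Fin (groundSize ε m)
  have hcard : 0 < Fintype.card F := Fintype.card_pos
  have hbad := card_not_spread_mul_le (r := drawCount m) (n := groundSize ε m) (unionParam ε m) hsm.le
  set bad := Finset.univ.filter fun f : F => ¬ Spread (unionParam ε m) (drawnSets f) with hbadDef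
  have hbm : bad.card * m ≤ Fintype.card F := by
    have h1 := Nat.mul_le_mul_left m hbad
    have h2 := Nat.mul_le_mul_right (Fintype.card F) hpow
    have h3 : 0 < 4 ^ (unionParam ε m * drawCount m) := by positivity
    refine Nat.le_of_mul_le_mul_right ?_ h3
    calc _ = m * (bad.card * 4 ^ (unionParam ε m * drawCount m)) := by ring
      _ ≤ _ := h1
      _ = _ := (mul_assoc _ _ _).symm
      _ ≤ _ := h2
      _ = _ := mul_comm _ _
  have hsum : ((Finset.univ.filter fun f : F => Spread (unionParam ε m) (drawnSets f)).card : ℝ) ≤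
      ∑ f : F, coinMeasure.real {ω | Rejects c (encodeMinUnion (drawnSets f) (unionParam ε m)) ω} := by
    rw [Finset.card_eq_sum_ones, Nat.cast_sum]
    refine (Finset.sum_le_sum fun f hf => ?_).trans (Finset.sum_le_sum_of_subset_of_nonneg
      (Finset.subset_univ _) fun f _ _ => measureReal_nonneg)
    have hf' := hrej f (Finset.mem_filter.1 hf).2
    rw [show {ω | Rejects c (encodeMinUnion (drawnSets f) (unionParam ε m)) ω} = Set.univ from
      Set.eq_univ_of_forall hf', measure_coins_univ, Nat.cast_one]
  have hsplit : (Finset.univ.filter fun f : F => Spread (unionParam ε m) (drawnSets f)).card +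
      bad.card = Fintype.card F := by
    rw [hbadDef, Finset.card_filter_add_card_filter_not, Finset.card_univ]
  have hcard' : (0 : ℝ) < Fintype.card F := by exact_mod_cast hcard
  have hm' : (0 : ℝ) < m := by exact_mod_cast hm
  rw [randomRejectProb, le_div_iff₀ hcard']
  refine le_trans ?_ hsum
  have e1 : (bad.card : ℝ) * m ≤ Fintype.card F := by exact_mod_cast hbm
  have e2 : ((Finset.univ.filter fun f : F => Spread (unionParam ε m) (drawnSets f)).card : ℝ) +
      bad.card = Fintype.card F := by exact_mod_cast hsplit
  have e3 : (bad.card : ℝ) ≤ Fintype.card F / m := (le_div_iff₀ hm').2 e1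
  calc (1 - 1 / (m : ℝ)) * Fintype.card F = Fintype.card F - Fintype.card F / m := by ring
    _ ≤ _ := by linarith

end FairClustering

namespace FairClustering

/-! ### The reduction -/

theorem not_approximates_of_lt_one {p : ℝ} (hp : 0 < p) {ρ : ℕ → ℝ}
    (hρ : ∀ᶠ m in atTop, ρ m < 1) (c : Program) : ¬ Approximates c p p ρ := by
  rintro ⟨-, happ⟩
  obtain ⟨m, hm, hm2⟩ := (hρ.and (eventually_ge_atTop 2)).exists
  set S : Fin m → Finset (Fin 1) := fun _ => Finset.univ
  have hs : 1 < m := hm2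
  have hmeas := happ (clusteringInstance S 1 hs)
  have hne : {ω | ∃ C : Finset (Fin m), (clusteringInstance S 1 hs).IsApprox p p (ρ m) C ∧
      Outputs c (clusteringInstance S 1 hs).encode ω (Data.ofFinset C)}.Nonempty := by
    by_contra h
    rw [Set.not_nonempty_iff_eq_empty] at h
    rw [h, measureReal_empty] at hmeas
    norm_num at hmeas
  obtain ⟨-, C, ⟨hCk, hle⟩, -⟩ := hne
  have hCk' : C.card = m - 1 := hCk
  have hCne : C.Nonempty := Finset.card_pos.1 (by omega)
  obtain ⟨j, hj⟩ : Cᶜ.Nonempty :=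
    Finset.card_pos.1 (by rw [Finset.card_compl, hCk', Fintype.card_fin]; omega)
  have h0 := cost_nonneg (clusteringInstance S 1 hs) p p C
  -- A solution `C` is compared with itself: `cost ≤ ρ * cost` with `ρ < 1` forces cost `0`,
  -- although the one non-center has positive weight.
  have hzero : (clusteringInstance S 1 hs).cost p p C = 0 := by
    have := hle C hCk
    nlinarith
  have hone := card_biUnion_le_cost_rpow S hs hCne hp hp
  rw [hzero, Real.zero_rpow hp.ne'] at hone
  have hpos : 0 < (Cᶜ.biUnion S).card :=
    Finset.card_pos.2 ⟨0, Finset.mem_biUnion.2 ⟨j, hj, Finset.mem_univ _⟩⟩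
  have : (0 : ℝ) < (Cᶜ.biUnion S).card := by exact_mod_cast hpos
  linarith

theorem card_drawnSets_le {m r n : ℕ} (f : Fin m → Fin r → Fin n) (j : Fin m) :
    (drawnSets f j).card ≤ r :=
  Finset.card_image_le.trans (by simp)

/-- An approximation algorithm for fair clustering yields an algorithm for Min `s`-Union that has
the same coins, and whose answer is determined by the output of the approximation algorithm. -/
theorem exists_distinguisher {c : Program} (hc : PolyTimeOn c (Set.range Instance.encode)) :
    ∃ d : Program, (c.Deterministic → d.Deterministic) ∧ PolyTimeOn d minUnionInputs ∧
      (∀ {m n : ℕ} (S : Fin m → Finset (Fin n)) (s : ℕ) (hs : s < m) (ω : ℕ → Bool) (y : Data),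
        Outputs c (clusteringInstance S s hs).encode ω y →
        Outputs d (encodeMinUnion S s) ω (answer (encodeMinUnion S s) y)) := by
  obtain ⟨d, P, hdet, hnil, hrun⟩ :=
    exists_reduction c polyComputable_toClustering polyComputable_answer
  obtain ⟨Pc, hPc⟩ := hc
  obtain ⟨Q, hQ⟩ := polyComputable_toClustering.size_le
  refine ⟨d, hdet, ⟨P.comp (Polynomial.X + Pc.comp Q), ?_⟩, ?_⟩
  · rintro _ ⟨m, n, s, S, -, hsm, rfl⟩ ω
    simp only [Polynomial.eval_comp, Polynomial.eval_add, Polynomial.eval_X]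
    -- For `s = m` there is no clustering instance; only the running time matters there.
    rcases hsm.eq_or_lt with rfl | hlt
    · obtain ⟨t, h1, h2⟩ := hnil (encodeMinUnion S s) ω
        ((head_toClustering_encodeMinUnion S s).2 le_rfl)
      exact ⟨_, t, h1, h2.trans (eval_mono P (Nat.le_add_right _ _))⟩
    · obtain ⟨y, t, h1, h2⟩ := hPc _ ⟨clusteringInstance S s hlt, rfl⟩ ω
      rw [← toClustering_encodeMinUnion] at h1 h2
      obtain ⟨t', h3, h4⟩ := hrun _ ω y t
        (fun h => absurd ((head_toClustering_encodeMinUnion S s).1 h) (by omega)) h1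
      exact ⟨_, t', h3, h4.trans (eval_mono P (Nat.add_le_add_left
        (h2.trans (eval_mono Pc (hQ _))) _))⟩
  · rintro m n S s hs ω y ⟨t, hy⟩
    rw [← toClustering_encodeMinUnion] at hy
    obtain ⟨t', h3, -⟩ := hrun _ ω y t
      (fun h => absurd ((head_toClustering_encodeMinUnion S s).1 h) (by omega)) hy
    exact ⟨t', h3⟩

/-- On dense inputs the event that the approximation succeeds is contained in the event of
acceptance, so the probability `2 / 3` carries over. On spread random inputs every output of the
algorithm leads to rejection, so only its halting is used. -/
theorem exists_distinguishes_of_approximates {p q ε δ : ℝ} (hq : 0 < q) (hqp : q < p) (hε : 0 < ε)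
    (hε1 : ε < 1) (hδ0 : 0 ≤ δ) (hδ : δ < 1) {ρ : ℕ → ℝ}
    (hρ : ∀ᶠ m : ℕ in atTop, ρ m < (m : ℝ) ^ (ε * (1 - δ) * (p - q) / (p * q))) {c : Program}
    (hc : Approximates c p q ρ) : ∃ d : Program, (c.Deterministic → d.Deterministic) ∧
      Distinguishes d ε δ (unionParam ε) := by
  obtain ⟨hpoly, happ⟩ := hc
  obtain ⟨d, hdet, hdpoly, hd⟩ := exists_distinguisher hpoly
  refine ⟨d, hdet, hdpoly, ?_, tendsto_randomRejectProb hε hε1 ?_⟩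
  · filter_upwards [hρ, eventually_four_mul_lt_groundSize hq hqp hε hδ0 hδ,
      eventually_unionParam_lt hε1, (tendsto_unionParam hε).eventually_ge_atTop 1]
      with m hρm hbound hsm hs1 S hS
    obtain ⟨J, T, hJ, hT, hJT⟩ := hS
    refine (happ (clusteringInstance S _ hsm)).trans ?_
    have : IsFiniteMeasure coinMeasure := by unfold coinMeasure; infer_instance
    refine measureReal_mono ?_
    rintro ω ⟨(C : Finset (Fin m)), hC, hout⟩
    have h := hd S _ hsm ω _ hout
    rw [answer_encodeMinUnion S _ hs1, unmarkedSet_ofFinset] at h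
    have htrue : (∃ j, groundSize ε m < unionParam ε m * (S j).card) ∨
        unionParam ε m ≤ Cᶜ.card ∧ 4 * (Cᶜ.biUnion S).card < groundSize ε m := by
      -- A large set is accepted at once; otherwise the total size of the hidden sets is at most `n`
      -- and the cost estimate applies.
      by_cases hbig : ∃ j, groundSize ε m < unionParam ε m * (S j).card
      · exact Or.inl hbig
      · push Not at hbig
        have hCk : C.card = m - unionParam ε m := hC.1
        refine Or.inr ⟨by rw [Finset.card_compl, hCk, Fintype.card_fin]; omega, ?_⟩
        have h1 := card_biUnion_le_of_isApprox S hsm hq hqp.le (by positivity) hρm.le hC hJ hJT hbig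
        have h2 := hbound _ _ (Nat.cast_nonneg _) hT h1
        exact_mod_cast h2
    rw [decide_eq_true htrue] at h
    exact h
  · filter_upwards [eventually_unionParam_lt hε1, (tendsto_unionParam hε).eventually_ge_atTop 1,
      eventually_ge_atTop 1] with m hsm hs1 hm1 f hf ω
    obtain ⟨P, hP⟩ := hpoly
    obtain ⟨y, t, hy, -⟩ := hP _ ⟨clusteringInstance (drawnSets f) _ hsm, rfl⟩ ω
    have h := hd (drawnSets f) _ hsm ω y ⟨t, hy⟩
    rw [answer_encodeMinUnion _ _ hs1, decide_eq_false] at h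
    · exact h
    · rintro (⟨j, hj⟩ | ⟨h1, h2⟩)
      · have := Nat.mul_le_mul_left (unionParam ε m) (card_drawnSets_le f j)
        have := unionParam_mul_drawCount_le ε hm1
        omega
      · have := hf _ h1
        omega

end FairClustering

theorem mainTheorem4 (mode : FairClustering.Mode) (p q ε δ : ℝ) (hq : 1 ≤ q) (hqp : q ≤ p)
    (hε : 0 < ε) (hεδ : ε < δ) (hδ : δ < 1) (hε2 : ε ≤ 1 / 2)
    (hconj : FairClustering.DenseVersusRandom mode ε δ (FairClustering.unionParam ε)) :
    FairClustering.HardToApproximateWithinLessThan mode p q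
      (fun m : ℕ => (m : ℝ) ^ (ε * (1 - δ) * (p - q) / (p * q))) := by
  rintro ρ hρ ⟨c, hadm, hc⟩
  have hq0 : 0 < q := by linarith
  -- For `p = q` the power of `ln m` that the reduction gains has exponent zero, so this case is
  -- treated directly.
  rcases hqp.eq_or_lt with rfl | hlt
  · simp only [sub_self, mul_zero, zero_div, Real.rpow_zero] at hρ
    exact FairClustering.not_approximates_of_lt_one hq0 hρ c hc
  · obtain ⟨d, hdet, hd⟩ := FairClustering.exists_distinguishes_of_approximates hq0 hlt hε
      (by linarith) (by linarith) hδ hρ hc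
    refine hconj ⟨d, ?_, hd⟩
    cases mode with
    | deterministic => exact hdet hadm
    | randomized => trivial
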